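/- Part A (exponential). Let $\nu\ge 1$ and let $X_1,\dots,X_\nu$ be a random sample from $\mathrm{Exp}(\lambda)$, $\lambda>0$, with density $\lambda e^{-\lambda x}$, $x>0$; put $X=X_1+\cdots+X_\nu$, let $\gamma$ be Euler's constant, and let $$L_\nu=-\log X-\gamma+\sum_{j=1}^{\nu-1}\frac1j .$$ Then $L_\nu$ is the uniformly minimum variance unbiased estimator (UMVUE) of $\log\lambda$: it is unbiased with finite variance for every $\lambda>0$, its variance is, for every $\lambda>0$, at most that of any other unbiased estimator of $\log\lambda$ based on the sample, and any UMVUE of $\log\lambda$ equals $L_\nu$ almost surely. Moreover, for every $\lambda>0$, $L_\nu=\mathbb E[-\gamma-\log X_1\mid X]$ almost surely, and $$\operatorname{Var}L_\nu=\sum_{k=1}^\infty\frac{1}{k^2\binom{\nu+k-1}{k}}=\sum_{k\ge\nu}\frac1{k^2}=\frac{\pi^2}{6}-\sum_{j=1}^{\nu-1}\frac1{j^2}.$$ The first term $1/\nu$ of the first series is the Cramér–Rao lower bound for unbiased estimators of $\log\lambda$, and $$1<\nu\operatorname{Var}L_\nu<1+\frac1\nu .$$ In particular $L_\nu$ is asymptotically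 efficient: for every $\lambda>0$ the ratio of $\operatorname{Var}L_\nu$ to the Cramér–Rao bound tends to $1$ as $\nu\to\infty$. Part B (geometric). Let $\nu\ge1$ and let $X_1,\dots,X_\nu$ be a random sample from the geometric distribution $p(x)=\theta(1-\theta)^x$, $x=0,1,2,\dots$, with $0<\theta<1$; put $X=X_1+\cdots+X_\nu$ and $T_\nu=\sum_{j=0}^{X-1}\frac{1}{\nu+j}$ (so $T_\nu=0$ if $X=0$). Then $T_\nu$ is the (almost surely unique) UMVUE of $-\log\theta$, and for every $\theta\in(0,1)$ $$\operatorname{Var}T_\nu=\sum_{k=1}^\infty\frac{(1-\theta)^k}{k^2\binom{\nu+k-1}{k}},$$ whose first term $(1-\theta)/\nu$ is the Cramér–Rao lower bound for unbiased estimators of $-\log\theta$. -/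

import Mathlib

open MeasureTheory ProbabilityTheory

noncomputable section

namespace PearsonUMVUE

/-- `δ` is an unbiased estimator of `g θ` in the statistical model `(P θ)_{θ ∈ Θ}`. -/
structure IsUnbiased {Θ S : Type*} [MeasurableSpace S] (P : Θ → Measure S) (g : Θ → ℝ)
    (δ : S → ℝ) : Prop where
  measurable : Measurable δ
  integrable : ∀ θ, Integrable δ (P θ)
  integral_eq : ∀ θ, ∫ x, δ x ∂(P θ) = g θ

/-- `T` is a uniformly minimum variance unbiased estimator of `g θ`: it is unbiased, has finite
variance for every parameter, and for every parameter its variance is at most that of any other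
unbiased estimator (whose variance, in `[0, ∞]`, is allowed to be infinite). -/
structure IsUMVUE {Θ S : Type*} [MeasurableSpace S] (P : Θ → Measure S) (g : Θ → ℝ)
    (T : S → ℝ) : Prop where
  unbiased : IsUnbiased P g T
  memLp : ∀ θ, MemLp T 2 (P θ)
  minimal : ∀ δ : S → ℝ, IsUnbiased P g δ → ∀ θ, evariance T (P θ) ≤ evariance δ (P θ)

/-- The law of a random sample of size `ν` from `Exp(l)`, with density `l e^{-l x}`, `x > 0`. -/
def expSample (ν : ℕ) (l : ℝ) : Measure (Fin ν → ℝ) :=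
  Measure.pi fun _ => expMeasure l

/-- The law of a random sample of size `ν` from the geometric distribution
`p(x) = θ (1 - θ) ^ x`, `x = 0, 1, …`, with `0 < θ < 1`. -/
def geomSample (ν : ℕ) (θ : Set.Ioo (0 : ℝ) 1) : Measure (Fin ν → ℕ) :=
  Measure.pi fun _ => geometricMeasure ⟨θ.1, θ.2.1.le, θ.2.2.le⟩

/-- `L_ν = - log X - γ + ∑_{j=1}^{ν-1} 1/j`, where `X` is the sample sum. -/
def L (ν : ℕ) (x : Fin ν → ℝ) : ℝ :=
  -Real.log (∑ i, x i) - Real.eulerMascheroniConstant + ∑ j ∈ Finset.Ico 1 ν, 1 / (j : ℝ)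

/-- `T_ν = 1/ν + 1/(ν+1) + ⋯ + 1/(ν+X-1)` (`0` if `X = 0`), where `X` is the sample sum. -/
def T (ν : ℕ) (x : Fin ν → ℕ) : ℝ :=
  ∑ j ∈ Finset.range (∑ i, x i), 1 / ((ν : ℝ) + j)

/-- The Fisher information at `t`, in one observation, of the family of densities `p t` with
respect to the reference measure `μ`. -/
def fisherInformation {S : Type*} [MeasurableSpace S] (μ : Measure S) (p : ℝ → S → ℝ)
    (t : ℝ) : ℝ :=
  ∫ x, (deriv (fun s => Real.log (p s x)) t) ^ 2 * p t x ∂μ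

/-- The Cramér–Rao lower bound at `t` for the variance of unbiased estimators of `g t` based on a
random sample of size `ν` from the density `p t` with respect to `μ`. -/
def cramerRaoBound {S : Type*} [MeasurableSpace S] (μ : Measure S) (p : ℝ → S → ℝ)
    (g : ℝ → ℝ) (ν : ℕ) (t : ℝ) : ℝ :=
  (deriv g t) ^ 2 / (ν * fisherInformation μ p t)

end PearsonUMVUE

end

namespace PearsonUMVUE

/-! Optimality in both models is Lehmann–Scheffé for a one-parameter exponential family. Multiplying
the law at `θ` by `c * exp (t * X)`, with `t` small, gives the law at another parameter. So an
estimator `U` that is unbiased for `0` at every parameter is orthogonal to `exp (t * X)` for all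
small `t`. Moment generating functions near `0` determine laws, hence `U` is orthogonal to every
function of `X` (`IsExpFamily.integral_mul_comp_eq_zero`). Minimal variance, almost sure uniqueness
and the conditional expectation all follow from this orthogonality. It remains to compute the mean
and variance of one function of `X`.

Exponential case: `X` has the gamma law of shape `ν`, under which `log` has moment generating
function `Γ (ν + t) / Γ ν * l ^ (-t)`. Its derivative at `0` gives the mean. The variance is the
limit of `(M t * M (-t) - 1) / t ^ 2`: at shape one the reflection formula turns `M t * M (-t)` into
`πt / sin πt`, giving `π ^ 2 / 6`, and raising the shape from `a` to `a + 1` subtracts `1 / a ^ 2`.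
The binomial series has the same value by induction on `ν` with a telescoping difference. Comparing
squares with products of consecutive terms gives the strict bounds, hence efficiency.

Geometric case: `X` is negative binomial, and moments are read from generating series in `q = 1 -
θ`. Write `N`, `Λ`, `V` for the series of the weights, of `-log (1 - q)` and of the claimed
variance. First-order differential equations show that the weighted series of the statistic and of
its square are `Λ N` and `(Λ ^ 2 + V) N` (`negBinSeries_tStat`, `negBinSeries_tStat_sq`). Since `N`
sums to `θ ^ (-ν)`, the variance is `V`. -/

open Filter Topology Complex in
/-- Two real random variables whose moment generating functions are finite and equal near `0` have
the same law. -/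
theorem map_eq_map_of_mgf_eventuallyEq {Ω Ω' : Type*} [MeasurableSpace Ω] [MeasurableSpace Ω']
    {μ : Measure Ω} {μ' : Measure Ω'} [IsFiniteMeasure μ] [IsFiniteMeasure μ']
    {X : Ω → ℝ} {Y : Ω' → ℝ}
    (hX : 0 ∈ interior (integrableExpSet X μ)) (hY : 0 ∈ interior (integrableExpSet Y μ'))
    (h : mgf X μ =ᶠ[𝓝 0] mgf Y μ') : μ.map X = μ'.map Y := by
  -- On this vertical strip both complex moment generating functions are analytic. It contains the
  -- imaginary axis, where they are the characteristic functions, so the identity theorem carries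
  -- equality there from the reals near `0`.
  set s : Set ℂ := {z | z.re ∈ interior (integrableExpSet X μ) ∩ interior (integrableExpSet Y μ')}
  have hsX : AnalyticOnNhd ℂ (complexMGF X μ) s :=
    analyticOnNhd_complexMGF.mono fun z hz => hz.1
  have hsY : AnalyticOnNhd ℂ (complexMGF Y μ') s :=
    analyticOnNhd_complexMGF.mono fun z hz => hz.2
  have hconv : Convex ℝ s :=
    (convex_integrableExpSet.interior.inter convex_integrableExpSet.interior).linear_preimage reLm
  have key : Set.EqOn (complexMGF X μ) (complexMGF Y μ') s := by
    refine AnalyticOnNhd.eqOn_of_preconnected_of_frequently_eq hsX hsY hconv.isPreconnected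
      (z₀ := ((0 : ℝ) : ℂ)) ⟨by simpa using hX, by simpa using hY⟩ ?_
    have h_real : ∃ᶠ (x : ℝ) in 𝓝[≠] 0, complexMGF X μ x = complexMGF Y μ' x := by
      refine Eventually.frequently ?_
      filter_upwards [h.filter_mono nhdsWithin_le_nhds] with y hy
      rw [complexMGF_ofReal, complexMGF_ofReal, hy]
    rw [frequently_iff_seq_forall] at h_real ⊢
    obtain ⟨xs, hx_tendsto, hx_eq⟩ := h_real
    refine ⟨fun n ↦ xs n, ?_, fun n ↦ ?_⟩
    · rw [tendsto_nhdsWithin_iff] at hx_tendsto ⊢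
      exact ⟨tendsto_ofReal_iff.2 hx_tendsto.1, by simpa using hx_tendsto.2⟩
    · simp [hx_eq]
  refine Measure.ext_of_charFun (funext fun t => ?_)
  rw [← complexMGF_mul_I (aemeasurable_of_mem_interior_integrableExpSet hX),
    ← complexMGF_mul_I (aemeasurable_of_mem_interior_integrableExpSet hY)]
  exact key ⟨by simpa using hX, by simpa using hY⟩

/-! ### Completeness: orthogonality to exponentials implies orthogonality to all functions of the
statistic. -/

section Completeness

variable {S : Type*} [MeasurableSpace S] {μ : Measure S}

/-- `ENNReal.ofReal` truncates at zero, so the density is the positive part of `U`. Used for `U` and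
`-U`, it represents the signed measure `U μ` as a difference of two measures. -/
theorem integrable_withDensity_ofReal_iff {U g : S → ℝ} (hU : Measurable U) :
    Integrable g (μ.withDensity fun x => ENNReal.ofReal (U x)) ↔
      Integrable (fun x => max (U x) 0 * g x) μ := by
  rw [integrable_withDensity_iff_integrable_smul' (by fun_prop) (by simp)]
  simp [ENNReal.toReal_ofReal']

theorem integral_withDensity_ofReal {U g : S → ℝ} (hU : Measurable U) :
    ∫ x, g x ∂(μ.withDensity fun x => ENNReal.ofReal (U x)) = ∫ x, max (U x) 0 * g x ∂μ := by
  rw [integral_withDensity_eq_integral_toReal_smul (by fun_prop) (by simp)]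
  simp [ENNReal.toReal_ofReal']

theorem integrable_max_zero_mul {U g : S → ℝ} (hU : Measurable U)
    (h : Integrable (fun x => U x * g x) μ) (hg : AEStronglyMeasurable g μ) :
    Integrable (fun x => max (U x) 0 * g x) μ := by
  refine h.mono (by fun_prop) (ae_of_all _ fun x => ?_)
  rw [norm_mul, norm_mul]
  gcongr
  simp only [Real.norm_eq_abs]
  rw [abs_of_nonneg (le_max_right _ _)]
  exact max_le (le_abs_self _) (abs_nonneg _)

open Filter Topology in
/-- If `U` is orthogonal to all the exponentials `e ^ {tX}` with `t` near `0`, it is orthogonal to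
every function of `X`. -/
theorem integral_mul_comp_eq_zero {X U : S → ℝ} (hX : Measurable X) (hU : Measurable U)
    (h : ∀ᶠ t in 𝓝 (0 : ℝ), Integrable (fun x => U x * Real.exp (t * X x)) μ ∧
      ∫ x, U x * Real.exp (t * X x) ∂μ = 0)
    {f : ℝ → ℝ} (hf : Measurable f) (hUf : Integrable (fun x => U x * f (X x)) μ) :
    ∫ x, U x * f (X x) ∂μ = 0 := by
  have hnU : Measurable fun x => -U x := hU.neg
  have hexp (t : ℝ) (ht : Integrable (fun x => U x * Real.exp (t * X x)) μ) :
      Integrable (fun x => -U x * Real.exp (t * X x)) μ := by simpa using ht.neg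
  have hU0 : Integrable U μ := by simpa using h.self_of_nhds.1
  have : IsFiniteMeasure (μ.withDensity fun x => ENNReal.ofReal (U x)) :=
    isFiniteMeasure_withDensity_ofReal hU0.2
  have : IsFiniteMeasure (μ.withDensity fun x => ENNReal.ofReal (-U x)) :=
    isFiniteMeasure_withDensity_ofReal hU0.neg.2
  have split {g : S → ℝ} (hg : Measurable g) (hi : Integrable (fun x => U x * g x) μ) :
      ∫ x, g x ∂(μ.withDensity fun x => ENNReal.ofReal (U x)) -
        ∫ x, g x ∂(μ.withDensity fun x => ENNReal.ofReal (-U x)) = ∫ x, U x * g x ∂μ := by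
    rw [integral_withDensity_ofReal hU, integral_withDensity_ofReal hnU, ← integral_sub]
    · refine integral_congr_ae (ae_of_all _ fun x => ?_)
      rcases le_total 0 (U x) with hx | hx <;> simp [hx]
    · exact integrable_max_zero_mul hU hi hg.aestronglyMeasurable
    · exact integrable_max_zero_mul hnU (by simpa using hi.neg) hg.aestronglyMeasurable
  -- The orthogonality hypothesis says that the positive and negative parts of `U μ` give `X` the
  -- same moment generating function near `0`.
  have hmap : (μ.withDensity fun x => ENNReal.ofReal (U x)).map X =
      (μ.withDensity fun x => ENNReal.ofReal (-U x)).map X := by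
    apply map_eq_map_of_mgf_eventuallyEq
    · rw [mem_interior_iff_mem_nhds]
      filter_upwards [h] with t ht
      exact (integrable_withDensity_ofReal_iff hU).2
        (integrable_max_zero_mul hU ht.1 (by fun_prop))
    · rw [mem_interior_iff_mem_nhds]
      filter_upwards [h] with t ht
      exact (integrable_withDensity_ofReal_iff hnU).2
        (integrable_max_zero_mul hnU (hexp t ht.1) (by fun_prop))
    · filter_upwards [h] with t ht
      have := split (g := fun x => Real.exp (t * X x)) (by fun_prop) ht.1
      rw [ht.2] at this
      exact sub_eq_zero.1 this
  rw [← split (g := fun x => f (X x)) (hf.comp hX) hUf, sub_eq_zero]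
  have e (ρ : Measure S) : ∫ x, f (X x) ∂ρ = ∫ y, f y ∂(ρ.map X) :=
    (integral_map hX.aemeasurable hf.aestronglyMeasurable).symm
  rw [e, e, hmap]

end Completeness

/-! ### Lehmann–Scheffé and Rao–Blackwell for exponential families. -/

section ExponentialFamily

variable {Θ S : Type*} [MeasurableSpace S]

/-- `P` is an exponential family with sufficient statistic `X`, whose natural parameter ranges over
an open set. -/
structure IsExpFamily (P : Θ → Measure S) (X : S → ℝ) : Prop where
  isProbabilityMeasure : ∀ θ, IsProbabilityMeasure (P θ)
  measurable : Measurable X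
  tilt : ∀ θ, ∀ᶠ t in nhds (0 : ℝ), ∃ θ', ∃ c : ℝ, 0 < c ∧
    P θ' = (P θ).withDensity fun x => ENNReal.ofReal (c * Real.exp (t * X x))

variable {P : Θ → Measure S} {X : S → ℝ} {g : Θ → ℝ}

/-- Unbiasedness for `0` at the tilted parameter is, up to the constant `c`, the vanishing of the
integral of `U * exp (t * X)` at `θ`; completeness then applies. -/
theorem IsExpFamily.integral_mul_comp_eq_zero (h : IsExpFamily P X) {U : S → ℝ}
    (hU : IsUnbiased P (fun _ => 0) U) {f : ℝ → ℝ} (hf : Measurable f) (θ : Θ)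
    (hUf : Integrable (fun x => U x * f (X x)) (P θ)) :
    ∫ x, U x * f (X x) ∂(P θ) = 0 := by
  have hX := h.measurable
  refine PearsonUMVUE.integral_mul_comp_eq_zero hX hU.measurable ?_ hf hUf
  filter_upwards [h.tilt θ] with t ⟨θ', c, hc, hP⟩
  have hm : Measurable fun x => c * Real.exp (t * X x) := by fun_prop
  have e : (fun x => max (c * Real.exp (t * X x)) 0 * U x) =
      fun x => c * (U x * Real.exp (t * X x)) := by
    ext x
    rw [max_eq_left (by positivity)]
    ring
  have h1 := hU.integrable θ'
  have h2 := hU.integral_eq θ'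
  rw [hP] at h1 h2
  rw [integrable_withDensity_ofReal_iff hm, e, integrable_const_mul_iff (by simpa using hc.ne')]
    at h1
  rw [integral_withDensity_ofReal hm, e, integral_const_mul] at h2
  exact ⟨h1, by simpa [hc.ne'] using h2⟩

theorem IsUnbiased.sub {δ δ' : S → ℝ} (h : IsUnbiased P g δ) (h' : IsUnbiased P g δ') :
    IsUnbiased P (fun _ => 0) (δ - δ') where
  measurable := h.measurable.sub h'.measurable
  integrable θ := (h.integrable θ).sub (h'.integrable θ)
  integral_eq θ := by
    simp only [Pi.sub_apply]
    rw [integral_sub (h.integrable θ) (h'.integrable θ), h.integral_eq, h'.integral_eq, sub_self]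

/-- The Pythagorean identity for an unbiased estimator that is a function of `X`. -/
theorem IsExpFamily.variance_eq_add (h : IsExpFamily P X) {f : ℝ → ℝ} (hf : Measurable f)
    (hT : IsUnbiased P g (f ∘ X)) {δ : S → ℝ} (hδ : IsUnbiased P g δ) {θ : Θ}
    (hT2 : MemLp (f ∘ X) 2 (P θ)) (hδ2 : MemLp δ 2 (P θ)) :
    variance δ (P θ) = variance (f ∘ X) (P θ) + variance (δ - f ∘ X) (P θ) := by
  have := h.isProbabilityMeasure θ
  have hU := hδ.sub hT
  have hU2 : MemLp (δ - f ∘ X) 2 (P θ) := hδ2.sub hT2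
  have hcov : cov[f ∘ X, δ - f ∘ X; P θ] = 0 := by
    rw [covariance_eq_sub hT2 hU2, hU.integral_eq θ, mul_zero, sub_zero]
    have := h.integral_mul_comp_eq_zero hU hf θ (hU2.integrable_mul hT2)
    simpa [mul_comm] using this
  have e : δ = f ∘ X + (δ - f ∘ X) := by simp
  conv_lhs => rw [e]
  rw [variance_add hT2 hU2, hcov]
  ring

/-- An unbiased estimator with finite variance that is a function of `X` is a UMVUE. -/
theorem IsExpFamily.isUMVUE (h : IsExpFamily P X) {f : ℝ → ℝ} (hf : Measurable f)
    (hT : IsUnbiased P g (f ∘ X)) (hT2 : ∀ θ, MemLp (f ∘ X) 2 (P θ)) :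
    IsUMVUE P g (f ∘ X) where
  unbiased := hT
  memLp := hT2
  minimal δ hδ θ := by
    have := h.isProbabilityMeasure θ
    by_cases hδ2 : MemLp δ 2 (P θ)
    · rw [← ofReal_variance (hT2 θ), ← ofReal_variance hδ2,
        h.variance_eq_add hf hT hδ (hT2 θ) hδ2]
      exact ENNReal.ofReal_le_ofReal (le_add_of_nonneg_right (variance_nonneg _ _))
    · rw [evariance_eq_top hδ.measurable.aestronglyMeasurable hδ2]
      exact le_top

/-- A UMVUE that is a function of `X` is almost surely the only UMVUE. -/
theorem IsExpFamily.ae_eq_of_isUMVUE (h : IsExpFamily P X) {f : ℝ → ℝ} (hf : Measurable f)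
    (hT : IsUMVUE P g (f ∘ X)) {T' : S → ℝ} (hT' : IsUMVUE P g T') (θ : Θ) :
    T' =ᵐ[P θ] f ∘ X := by
  have := h.isProbabilityMeasure θ
  have hle : variance T' (P θ) ≤ variance (f ∘ X) (P θ) := by
    rw [← ENNReal.ofReal_le_ofReal_iff (variance_nonneg _ _), ofReal_variance (hT'.memLp θ),
      ofReal_variance (hT.memLp θ)]
    exact hT'.minimal _ hT.unbiased θ
  have hU := hT'.unbiased.sub hT.unbiased
  have hz : variance (T' - f ∘ X) (P θ) = 0 := by
    have := h.variance_eq_add hf hT.unbiased hT'.unbiased (hT.memLp θ) (hT'.memLp θ)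
    linarith [variance_nonneg (T' - f ∘ X) (P θ)]
  filter_upwards [ae_eq_integral_of_variance_eq_zero ((hT'.memLp θ).sub (hT.memLp θ)) hz]
    with x hx
  rw [hU.integral_eq θ] at hx
  simpa [sub_eq_zero] using hx

/-- Conditioning an unbiased estimator on `X` gives the unbiased estimator based on `X`. -/
theorem IsExpFamily.condExp_ae_eq (h : IsExpFamily P X) {f : ℝ → ℝ} (hf : Measurable f)
    (hT : IsUnbiased P g (f ∘ X)) {δ : S → ℝ} (hδ : IsUnbiased P g δ) (θ : Θ) :
    (P θ)[δ | MeasurableSpace.comap X inferInstance] =ᵐ[P θ] f ∘ X := by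
  have := h.isProbabilityMeasure θ
  have hle : MeasurableSpace.comap X inferInstance ≤ (inferInstance : MeasurableSpace S) :=
    h.measurable.comap_le
  refine (ae_eq_condExp_of_forall_setIntegral_eq hle (hδ.integrable θ)
    (fun s _ _ => (hT.integrable θ).integrableOn) ?_ ?_).symm
  · rintro s ⟨B, hB, rfl⟩ -
    have hU := hδ.sub hT
    have hms : MeasurableSet (X ⁻¹' B) := h.measurable hB
    have e : (fun x => (δ - f ∘ X) x * B.indicator 1 (X x)) =
        (X ⁻¹' B).indicator (δ - f ∘ X) := by
      ext x
      by_cases hx : X x ∈ B <;> simp [hx]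
    -- Orthogonality to the indicator of `B` evaluated at `X` is the equality of set integrals over
    -- `X ⁻¹' B` that characterises the conditional expectation.
    have key := h.integral_mul_comp_eq_zero hU (f := B.indicator 1) (measurable_one.indicator hB) θ
      (by rw [e]; exact (hU.integrable θ).indicator hms)
    rw [e, integral_indicator hms] at key
    simp only [Pi.sub_apply] at key
    rw [integral_sub (hδ.integrable θ).integrableOn (hT.integrable θ).integrableOn] at key
    linarith
  · exact (hf.comp (comap_measurable X)).aestronglyMeasurable

end ExponentialFamily

/-! ### Independent samples: product densities and sums. -/

section Product

variable {ι S : Type*} [Fintype ι] [MeasurableSpace S]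

/-- On a box, the product density times the indicator is a product of functions of separate
coordinates, so independence factors its integral; boxes determine the product measure. -/
theorem pi_withDensity {μ : Measure S} [IsProbabilityMeasure μ] {f : S → ENNReal}
    (hf : Measurable f) [SigmaFinite (μ.withDensity f)] :
    Measure.pi (fun _ : ι => μ.withDensity f) =
      (Measure.pi fun _ : ι => μ).withDensity fun x => ∏ i, f (x i) := by
  refine Measure.pi_eq fun s hs => ?_
  rw [withDensity_apply _ (MeasurableSet.univ_pi hs),
    ← lintegral_indicator (MeasurableSet.univ_pi hs)]
  have e : (Set.univ.pi s).indicator (fun x : ι → S => ∏ i, f (x i)) =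
      fun x => ∏ i, (s i).indicator f (x i) := by
    ext x
    by_cases hx : x ∈ Set.univ.pi s
    · rw [Set.indicator_of_mem hx]
      exact Finset.prod_congr rfl fun i _ => (Set.indicator_of_mem (hx i trivial) f).symm
    · rw [Set.indicator_of_notMem hx]
      obtain ⟨i, hi⟩ : ∃ i, x i ∉ s i := by simpa using hx
      exact (Finset.prod_eq_zero (Finset.mem_univ i) (Set.indicator_of_notMem hi f)).symm
  have hind : iIndepFun (fun i (x : ι → S) => (s i).indicator f (x i))
      (Measure.pi fun _ : ι => μ) :=
    iIndepFun_pi (X := fun i => (s i).indicator f) fun i => (hf.indicator (hs i)).aemeasurable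
  rw [e, lintegral_prod_eq_prod_lintegral_of_indepFun Finset.univ _ hind
    fun i => (hf.indicator (hs i)).comp (measurable_pi_apply i)]
  refine Finset.prod_congr rfl fun i _ => ?_
  rw [withDensity_apply _ (hs i), ← lintegral_indicator (hs i)]
  exact (measurePreserving_eval (fun _ : ι => μ) i).lintegral_comp (hf.indicator (hs i))

/-- Random samples from an exponential family form an exponential family. -/
theorem IsExpFamily.pi {Θ : Type*} {P : Θ → Measure S} {X : S → ℝ} (h : IsExpFamily P X) :
    IsExpFamily (fun θ => Measure.pi fun _ : ι => P θ) (fun x => ∑ i, X (x i)) where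
  isProbabilityMeasure θ := by
    have := h.isProbabilityMeasure θ
    infer_instance
  measurable := by
    have := h.measurable
    fun_prop
  tilt θ := by
    have := h.isProbabilityMeasure θ
    have hX := h.measurable
    filter_upwards [h.tilt θ] with t ⟨θ', c, hc, hP⟩
    refine ⟨θ', c ^ Fintype.card ι, by positivity, ?_⟩
    have : SigmaFinite ((P θ).withDensity fun x => ENNReal.ofReal (c * Real.exp (t * X x))) := by
      have := h.isProbabilityMeasure θ'
      rw [← hP]
      infer_instance
    simp only [hP]
    rw [pi_withDensity (by fun_prop)]
    congr 1
    ext x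
    rw [← ENNReal.ofReal_prod_of_nonneg fun i _ => by positivity, Finset.prod_mul_distrib,
      Finset.prod_const, ← Real.exp_sum, Finset.mul_sum, Finset.card_univ]

/-- The moment generating function of a sample sum. -/
theorem mgf_sum_pi {μ : Measure S} [IsProbabilityMeasure μ] {X : S → ℝ} (hX : Measurable X)
    (t : ℝ) :
    mgf (fun x : ι → S => ∑ i, X (x i)) (Measure.pi fun _ => μ) t =
      mgf X μ t ^ Fintype.card ι := by
  have hind : iIndepFun (fun i (x : ι → S) => X (x i)) (Measure.pi fun _ : ι => μ) :=
    iIndepFun_pi (X := fun _ => X) fun i => hX.aemeasurable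
  have := hind.mgf_sum (fun i => hX.comp (measurable_pi_apply i)) Finset.univ (t := t)
  have e : (fun x : ι → S => ∑ i, X (x i)) = ∑ i, fun x : ι → S => X (x i) := by
    ext x
    simp
  rw [e, this]
  have e2 (i : ι) : mgf (fun x : ι → S => X (x i)) (Measure.pi fun _ => μ) t = mgf X μ t := by
    have hm := (measurePreserving_eval (fun _ : ι => μ) i).map_eq
    conv_rhs => rw [← hm]
    rw [mgf, mgf, integral_map (measurable_pi_apply i).aemeasurable (by fun_prop)]
  simp [e2]

theorem integrable_exp_sum_pi {μ : Measure S} [IsProbabilityMeasure μ] {X : S → ℝ}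
    {t : ℝ} (h : Integrable (fun y => Real.exp (t * X y)) μ) :
    Integrable (fun x : ι → S => Real.exp (t * ∑ i, X (x i))) (Measure.pi fun _ => μ) := by
  have := Integrable.fintype_prod (μ := fun _ : ι => μ) (f := fun _ y => Real.exp (t * X y))
    fun _ => h
  simpa [Finset.mul_sum, Real.exp_sum] using this

end Product

/-! ### Moment generating functions from tilts, and the variance from a second difference. -/

section MGF

open Filter Topology

/-- The tilted measure has total mass one, so its normalising constant is the reciprocal of the
moment generating function. Recognising a tilt as a known law thus replaces computing an integral.
-/
theorem integrable_exp_and_mgf_eq_of_withDensity {S : Type*} [MeasurableSpace S] {μ : Measure S}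
    {X : S → ℝ} (hX : Measurable X) {c t : ℝ} (hc : 0 < c)
    (h : IsProbabilityMeasure (μ.withDensity fun x => ENNReal.ofReal (c * Real.exp (t * X x)))) :
    Integrable (fun x => Real.exp (t * X x)) μ ∧ mgf X μ t = c⁻¹ := by
  have hm : Measurable fun x => c * Real.exp (t * X x) := by fun_prop
  have e : (fun x => max (c * Real.exp (t * X x)) 0 * 1) =
      fun x => c * Real.exp (t * X x) := by
    ext x
    rw [max_eq_left (by positivity), mul_one]
  have h1 : Integrable (fun _ => (1 : ℝ))
      (μ.withDensity fun x => ENNReal.ofReal (c * Real.exp (t * X x))) := integrable_const 1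
  have h2 : ∫ _, (1 : ℝ) ∂(μ.withDensity fun x => ENNReal.ofReal (c * Real.exp (t * X x))) = 1 := by
    simp
  rw [integrable_withDensity_ofReal_iff hm, e, integrable_const_mul_iff (by simpa using hc.ne')]
    at h1
  rw [integral_withDensity_ofReal hm, e, integral_const_mul] at h2
  exact ⟨h1, eq_inv_of_mul_eq_one_right h2⟩

/-- The variance as a symmetric second difference of the moment generating function. -/
theorem tendsto_mgf_mul_mgf_neg {S : Type*} [MeasurableSpace S] {μ : Measure S}
    [IsProbabilityMeasure μ] {X : S → ℝ} (h : 0 ∈ interior (integrableExpSet X μ)) :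
    Tendsto (fun t => (mgf X μ t * mgf X μ (-t) - 1) / t ^ 2) (𝓝[≠] 0) (𝓝 (variance X μ)) := by
  set M := mgf X μ
  set M' : ℝ → ℝ := fun t => ∫ x, X x * Real.exp (t * X x) ∂μ
  have hev : ∀ᶠ t in 𝓝 (0 : ℝ), t ∈ interior (integrableExpSet X μ) :=
    isOpen_interior.mem_nhds h
  have hevn : ∀ᶠ t in 𝓝 (0 : ℝ), -t ∈ interior (integrableExpSet X μ) := by
    have : Tendsto (fun t : ℝ => -t) (𝓝 0) (𝓝 0) := by simpa using tendsto_neg (0 : ℝ)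
    exact this.eventually hev
  have hM {t : ℝ} (ht : t ∈ interior (integrableExpSet X μ)) : HasDerivAt M (M' t) t :=
    hasDerivAt_mgf ht
  have hMn {t : ℝ} (ht : -t ∈ interior (integrableExpSet X μ)) :
      HasDerivAt (fun t => M (-t)) (-M' (-t)) t := by
    simpa [Function.comp_def] using (hM ht).scomp t (hasDerivAt_neg t)
  have hM'0 : HasDerivAt M' (∫ x, X x ^ 2 ∂μ) 0 := by
    have := hasDerivAt_integral_pow_mul_exp_real h 1
    simpa [M'] using this
  have hM'n0 : HasDerivAt (fun t => M' (-t)) (-∫ x, X x ^ 2 ∂μ) 0 := by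
    have h' : HasDerivAt M' (∫ x, X x ^ 2 ∂μ) (-0) := by simpa using hM'0
    simpa [Function.comp_def] using h'.scomp (0 : ℝ) (hasDerivAt_neg (0 : ℝ))
  have hM0 : M 0 = 1 := by simp [M]
  have hX2 : MemLp X 2 μ := by exact_mod_cast memLp_of_mem_interior_integrableExpSet h 2
  have hder : HasDerivAt (fun t => M' t * M (-t) - M t * M' (-t)) (2 * variance X μ) 0 := by
    have h1 := (hM'0.mul (hMn (by simpa using h))).sub ((hM h).mul hM'n0)
    have hM'00 : M' 0 = ∫ x, X x ∂μ := by simp [M']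
    convert! h1 using 1
    rw [variance_eq_sub hX2]
    simp only [neg_zero, hM0, hM'00, Pi.pow_apply]
    ring
  -- After one use of l'Hôpital the quotient is half the difference quotient at `0` of a function
  -- vanishing there with derivative `2 * variance X μ`.
  refine HasDerivAt.lhopital_zero_nhdsNE (f' := fun t => M' t * M (-t) - M t * M' (-t))
    (g' := fun t => 2 * t) ?_ ?_ ?_ ?_ ?_ ?_
  · refine Filter.Eventually.filter_mono nhdsWithin_le_nhds ?_
    filter_upwards [hev, hevn] with t ht htn
    convert! ((hM ht).mul (hMn htn)).sub_const 1 using 1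
    ring
  · exact Eventually.of_forall fun t => by simpa using hasDerivAt_pow 2 t
  · filter_upwards [self_mem_nhdsWithin] with t ht
    simpa using ht
  · have : ContinuousAt (fun t => M t * M (-t) - 1) 0 :=
      (((hM h).mul (hMn (by simpa using h))).sub_const 1).continuousAt
    have h2 := this.tendsto.mono_left (nhdsWithin_le_nhds (s := {0}ᶜ))
    simpa [hM0] using h2
  · have : ContinuousAt (fun t : ℝ => t ^ 2) 0 := by fun_prop
    simpa using this.tendsto.mono_left (nhdsWithin_le_nhds (s := {0}ᶜ))
  · have h2 := (hasDerivAt_iff_tendsto_slope_zero.1 hder).const_mul (1 / 2)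
    refine (h2.congr fun t => ?_).congr' EventuallyEq.rfl |>.trans (by simp)
    simp only [zero_add, neg_zero, smul_eq_mul]
    ring

end MGF

/-! ### The logarithm of a gamma variable. -/

section Gamma

open Filter Topology

/-- Gamma densities vanish on the negative axis and the origin is null, so comparing densities at
positive points suffices. -/
theorem gammaMeasure_eq_withDensity {a r a' r' : ℝ} (ha : 0 < a) (hr : 0 < r) {h : ℝ → ℝ}
    (hm : Measurable h)
    (heq : ∀ x, 0 < x → gammaPDFReal a' r' x = gammaPDFReal a r x * h x) :
    gammaMeasure a' r' = (gammaMeasure a r).withDensity fun x => ENNReal.ofReal (h x) := by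
  have hg : Measurable (gammaPDF a r) := (measurable_gammaPDFReal a r).ennreal_ofReal
  rw [gammaMeasure, gammaMeasure, ← withDensity_mul _ hg (by fun_prop)]
  refine withDensity_congr_ae ?_
  filter_upwards [Measure.ae_ne volume (0 : ℝ)] with x hx
  rcases hx.lt_or_gt with hx | hx
  · simp [gammaPDF_of_neg hx]
  · simp only [Pi.mul_apply, gammaPDF]
    rw [heq x hx, ENNReal.ofReal_mul (gammaPDFReal_nonneg ha hr x)]

theorem gammaMeasure_tilt {a r t : ℝ} (ha : 0 < a) (hr : 0 < r) (ht : t < r) :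
    gammaMeasure a (r - t) = (gammaMeasure a r).withDensity
      fun x => ENNReal.ofReal (((r - t) / r) ^ a * Real.exp (t * x)) := by
  refine gammaMeasure_eq_withDensity ha hr (by fun_prop) fun x hx => ?_
  have h1 : 0 < r ^ a := Real.rpow_pos_of_pos hr a
  rw [gammaPDFReal, gammaPDFReal, if_pos hx.le, if_pos hx.le, Real.div_rpow (by linarith) hr.le,
    show -((r - t) * x) = -(r * x) + t * x by ring, Real.exp_add]
  field_simp

/-- Tilting by `log x` multiplies the density by a power of `x`, which shifts the shape; tilting by
`x` itself shifts the rate. -/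
theorem gammaMeasure_tilt_log {a r t : ℝ} (ha : 0 < a) (hr : 0 < r) (ht : 0 < a + t) :
    gammaMeasure (a + t) r = (gammaMeasure a r).withDensity
      fun x => ENNReal.ofReal
        (r ^ t * Real.Gamma a / Real.Gamma (a + t) * Real.exp (t * Real.log x)) := by
  refine gammaMeasure_eq_withDensity ha hr (by fun_prop) fun x hx => ?_
  have h1 := Real.Gamma_pos_of_pos ha
  rw [gammaPDFReal, gammaPDFReal, if_pos hx.le, if_pos hx.le, Real.rpow_add hr,
    show a + t - 1 = (a - 1) + t by ring, Real.rpow_add hx, Real.rpow_def_of_pos hx t,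
    mul_comm (Real.log x) t]
  field_simp

theorem mgf_id_gammaMeasure {a r t : ℝ} (ha : 0 < a) (hr : 0 < r) (ht : t < r) :
    Integrable (fun x => Real.exp (t * x)) (gammaMeasure a r) ∧
      mgf (fun x => x) (gammaMeasure a r) t = (r / (r - t)) ^ a := by
  have hrt : 0 < r - t := by linarith
  have h := integrable_exp_and_mgf_eq_of_withDensity (μ := gammaMeasure a r) (X := fun x => x)
    (c := ((r - t) / r) ^ a) (t := t) measurable_id (by positivity)
    (by rw [← gammaMeasure_tilt ha hr ht]; exact isProbabilityMeasure_gammaMeasure ha hrt)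
  refine ⟨h.1, ?_⟩
  rw [h.2, ← Real.inv_rpow (by positivity), inv_div]

theorem mgf_log_gammaMeasure {a r t : ℝ} (ha : 0 < a) (hr : 0 < r) (ht : 0 < a + t) :
    Integrable (fun x => Real.exp (t * Real.log x)) (gammaMeasure a r) ∧
      mgf Real.log (gammaMeasure a r) t = Real.Gamma (a + t) / Real.Gamma a * r ^ (-t) := by
  have h1 := Real.Gamma_pos_of_pos ha
  have h2 := Real.Gamma_pos_of_pos ht
  have h := integrable_exp_and_mgf_eq_of_withDensity (μ := gammaMeasure a r) (X := Real.log)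
    (c := r ^ t * Real.Gamma a / Real.Gamma (a + t)) (t := t) Real.measurable_log (by positivity)
    (by rw [← gammaMeasure_tilt_log ha hr ht]; exact isProbabilityMeasure_gammaMeasure ht hr)
  refine ⟨h.1, ?_⟩
  rw [h.2, Real.rpow_neg hr.le, inv_div]
  field_simp

theorem zero_mem_interior_integrableExpSet_log {a r : ℝ} (ha : 0 < a) (hr : 0 < r) :
    0 ∈ interior (integrableExpSet Real.log (gammaMeasure a r)) := by
  rw [mem_interior_iff_mem_nhds]
  filter_upwards [Ioi_mem_nhds (show -a < 0 by linarith)] with t ht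
  exact (mgf_log_gammaMeasure ha hr (by linarith [Set.mem_Ioi.1 ht])).1

theorem memLp_log_gammaMeasure {a r : ℝ} (ha : 0 < a) (hr : 0 < r) :
    MemLp Real.log 2 (gammaMeasure a r) := by
  exact_mod_cast memLp_of_mem_interior_integrableExpSet
    (zero_mem_interior_integrableExpSet_log ha hr) 2

/-- The mean is the derivative at `0` of the moment generating function. Differentiating `Γ` at `n +
1` produces `-γ` plus a harmonic number, and the rate factor contributes `-log r`. -/
theorem integral_log_gammaMeasure {n : ℕ} {r : ℝ} (hr : 0 < r) :
    ∫ x, Real.log x ∂(gammaMeasure (n + 1) r) =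
      -Real.eulerMascheroniConstant + harmonic n - Real.log r := by
  have ha : (0 : ℝ) < n + 1 := by positivity
  have h0 := zero_mem_interior_integrableExpSet_log ha hr
  have hG : Real.Gamma (n + 1) = n.factorial := Real.Gamma_nat_eq_factorial n
  have h1 : HasDerivAt (fun t : ℝ => Real.Gamma (n + 1 + t) / Real.Gamma (n + 1) * r ^ (-t))
      (-Real.eulerMascheroniConstant + harmonic n - Real.log r) 0 := by
    have hd : HasDerivAt (fun t : ℝ => Real.Gamma (n + 1 + t))
        (n.factorial * (-Real.eulerMascheroniConstant + harmonic n)) 0 :=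
      HasDerivAt.comp_const_add (n + 1 : ℝ) 0 (by simpa using Real.hasDerivAt_Gamma_nat n)
    have hp : HasDerivAt (fun t : ℝ => r ^ (-t)) (-Real.log r) 0 := by
      have := (hasDerivAt_neg (0 : ℝ)).const_rpow hr
      simpa using this
    have hf : (n.factorial : ℝ) ≠ 0 := by positivity
    convert! (hd.div_const (Real.Gamma (n + 1))).mul hp using 1
    simp only [hG, neg_zero, Real.rpow_zero, add_zero]
    field_simp
    ring
  have h2 : mgf Real.log (gammaMeasure (n + 1) r) =ᶠ[𝓝 0]
      fun t : ℝ => Real.Gamma (n + 1 + t) / Real.Gamma (n + 1) * r ^ (-t) := by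
    filter_upwards [Ioi_mem_nhds (show -(n + 1 : ℝ) < 0 by linarith)] with t ht
    exact (mgf_log_gammaMeasure ha hr (by linarith [Set.mem_Ioi.1 ht])).2
  have := isProbabilityMeasure_gammaMeasure ha hr
  have h3 := hasDerivAt_mgf h0
  simpa using ((h1.congr_of_eventuallyEq h2).unique h3).symm

/-- Applied at `x = πt`, this limit is the source of `π ^ 2 / 6`. It comes from the cubic Taylor
bound for the sine. -/
theorem tendsto_div_sin_sub_one :
    Tendsto (fun x : ℝ => (x / Real.sin x - 1) / x ^ 2) (𝓝[≠] 0) (𝓝 (1 / 6)) := by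
  have h1 : Tendsto (fun x : ℝ => (x - Real.sin x) / x ^ 3) (𝓝[≠] 0) (𝓝 (1 / 6)) := by
    rw [tendsto_iff_norm_sub_tendsto_zero]
    have hb : Tendsto (fun x : ℝ => |x| ^ 2 / 100) (𝓝[≠] 0) (𝓝 0) := by
      have : ContinuousAt (fun x : ℝ => |x| ^ 2 / 100) 0 := by fun_prop
      simpa using this.tendsto.mono_left (nhdsWithin_le_nhds (s := {0}ᶜ))
    refine squeeze_zero' (Eventually.of_forall fun x => norm_nonneg _) ?_ hb
    have hball : ∀ᶠ x : ℝ in 𝓝[≠] 0, |x| ≤ 1 := by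
      refine Filter.Eventually.filter_mono nhdsWithin_le_nhds ?_
      filter_upwards [Metric.closedBall_mem_nhds (0 : ℝ) one_pos] with x hx
      simpa using hx
    filter_upwards [self_mem_nhdsWithin, hball] with x hx0 hx1
    have hx0 : x ≠ 0 := hx0
    have hpos : 0 < |x| := abs_pos.2 hx0
    have e : (x - Real.sin x) / x ^ 3 - 1 / 6 = -((Real.sin x - (x - x ^ 3 / 6)) / x ^ 3) := by
      field_simp
      ring
    rw [e, norm_neg, Real.norm_eq_abs, abs_div, abs_pow, div_le_iff₀ (by positivity)]
    calc _ ≤ |x| ^ 5 / 100 := Real.sin_bound hx1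
      _ = _ := by ring
  have h2 : Tendsto (fun x : ℝ => (Real.sinc x)⁻¹) (𝓝[≠] 0) (𝓝 1) := by
    have : Tendsto Real.sinc (𝓝[≠] 0) (𝓝 1) := by
      simpa using (Real.continuous_sinc.tendsto 0).mono_left (nhdsWithin_le_nhds (s := {0}ᶜ))
    simpa using this.inv₀ one_ne_zero
  have h3 := h1.mul h2
  rw [mul_one] at h3
  refine h3.congr' ?_
  have hsin : ∀ᶠ x : ℝ in 𝓝[≠] 0, Real.sinc x ≠ 0 := by
    refine Filter.Eventually.filter_mono nhdsWithin_le_nhds ?_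
    exact Real.continuous_sinc.continuousAt.eventually_ne (by simp)
  filter_upwards [self_mem_nhdsWithin, hsin] with x hx0 hx
  have hx0 : x ≠ 0 := hx0
  rw [Real.sinc_of_ne_zero hx0] at hx ⊢
  have : Real.sin x ≠ 0 := fun h => hx (by simp [h])
  field_simp

/-- In `M t * M (-t)` the powers of `r` cancel and `Γ (1 + t) * Γ (1 - t) = πt / sin πt` by
reflection. -/
theorem variance_log_gammaMeasure_one {r : ℝ} (hr : 0 < r) :
    variance Real.log (gammaMeasure 1 r) = Real.pi ^ 2 / 6 := by
  have := isProbabilityMeasure_gammaMeasure one_pos hr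
  refine tendsto_nhds_unique
    (tendsto_mgf_mul_mgf_neg (zero_mem_interior_integrableExpSet_log one_pos hr)) ?_
  have hlin : Tendsto (fun t : ℝ => Real.pi * t) (𝓝[≠] 0) (𝓝[≠] 0) := by
    rw [tendsto_nhdsWithin_iff]
    constructor
    · have : ContinuousAt (fun t : ℝ => Real.pi * t) 0 := by fun_prop
      simpa using this.tendsto.mono_left (nhdsWithin_le_nhds (s := {0}ᶜ))
    · filter_upwards [self_mem_nhdsWithin] with t ht
      simpa [Real.pi_ne_zero] using ht
  have h := (tendsto_div_sin_sub_one.comp hlin).const_mul (Real.pi ^ 2)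
  rw [show Real.pi ^ 2 / 6 = Real.pi ^ 2 * (1 / 6) by ring]
  refine h.congr' ?_
  have hball : ∀ᶠ x : ℝ in 𝓝[≠] 0, x ∈ Set.Ioo (-1) 1 :=
    Filter.Eventually.filter_mono nhdsWithin_le_nhds (Ioo_mem_nhds (by norm_num) (by norm_num))
  filter_upwards [self_mem_nhdsWithin, hball] with t ht0 ht
  have ht0 : t ≠ 0 := ht0
  rw [(mgf_log_gammaMeasure one_pos hr (by linarith [ht.1])).2,
    (mgf_log_gammaMeasure one_pos hr (by linarith [ht.2])).2]
  have e1 : Real.Gamma (1 + t) * Real.Gamma (1 + -t) = Real.pi * t / Real.sin (Real.pi * t) := by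
    rw [add_comm 1 t, Real.Gamma_add_one ht0, ← sub_eq_add_neg, mul_assoc,
      Real.Gamma_mul_Gamma_one_sub]
    ring
  have e2 : r ^ (-t) * r ^ (- -t) = 1 := by
    rw [← Real.rpow_add hr]
    simp
  have e3 : Real.Gamma (1 + t) / Real.Gamma 1 * r ^ (-t) *
      (Real.Gamma (1 + -t) / Real.Gamma 1 * r ^ (- -t)) =
      Real.Gamma (1 + t) * Real.Gamma (1 + -t) * (r ^ (-t) * r ^ (- -t)) := by
    rw [Real.Gamma_one]
    ring
  rw [e3, e1, e2]
  simp only [Function.comp_apply]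
  have := Real.pi_ne_zero
  field_simp

/-- The functional equation of `Γ` multiplies `M t * M (-t)` by `(a + t) * (a - t) / a ^ 2 = 1 - t ^
2 / a ^ 2`, which lowers the limiting second difference by `1 / a ^ 2`. -/
theorem variance_log_gammaMeasure_add_one {a r : ℝ} (ha : 0 < a) (hr : 0 < r) :
    variance Real.log (gammaMeasure (a + 1) r) =
      variance Real.log (gammaMeasure a r) - 1 / a ^ 2 := by
  have ha1 : 0 < a + 1 := by linarith
  have := isProbabilityMeasure_gammaMeasure ha hr
  have := isProbabilityMeasure_gammaMeasure ha1 hr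
  refine tendsto_nhds_unique
    (tendsto_mgf_mul_mgf_neg (zero_mem_interior_integrableExpSet_log ha1 hr)) ?_
  have h1 := tendsto_mgf_mul_mgf_neg (zero_mem_interior_integrableExpSet_log ha hr)
  have h2 : Tendsto (fun t : ℝ => 1 - t ^ 2 / a ^ 2) (𝓝[≠] 0) (𝓝 1) := by
    have : ContinuousAt (fun t : ℝ => 1 - t ^ 2 / a ^ 2) 0 := by fun_prop
    simpa using this.tendsto.mono_left (nhdsWithin_le_nhds (s := {0}ᶜ))
  have h3 := (h2.mul h1).sub_const (1 / a ^ 2)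
  rw [one_mul] at h3
  refine h3.congr' ?_
  have hball : ∀ᶠ x : ℝ in 𝓝[≠] 0, x ∈ Set.Ioo (-a) a :=
    Filter.Eventually.filter_mono nhdsWithin_le_nhds (Ioo_mem_nhds (by linarith) ha)
  filter_upwards [self_mem_nhdsWithin, hball] with t ht0 ht
  have ht0 : t ≠ 0 := ht0
  have hp : 0 < a + t := by linarith [ht.1]
  have hn : 0 < a + -t := by linarith [ht.2]
  rw [(mgf_log_gammaMeasure ha hr hp).2, (mgf_log_gammaMeasure ha hr hn).2,
    (mgf_log_gammaMeasure ha1 hr (by linarith)).2, (mgf_log_gammaMeasure ha1 hr (by linarith)).2,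
    add_right_comm a 1 t, add_right_comm a 1 (-t), Real.Gamma_add_one ha.ne',
    Real.Gamma_add_one hp.ne', Real.Gamma_add_one hn.ne']
  have := (Real.Gamma_pos_of_pos ha).ne'
  field_simp
  ring

theorem variance_log_gammaMeasure (n : ℕ) {r : ℝ} (hr : 0 < r) :
    variance Real.log (gammaMeasure (n + 1) r) =
      Real.pi ^ 2 / 6 - ∑ j ∈ Finset.Ico 1 (n + 1), 1 / (j : ℝ) ^ 2 := by
  induction n with
  | zero => simpa using variance_log_gammaMeasure_one hr
  | succ n ih =>
    rw [Finset.sum_Ico_succ_top (by lia)]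
    push_cast
    rw [variance_log_gammaMeasure_add_one (by positivity) hr, ih]
    ring

end Gamma

/-! ### Series for the exponential variance, and the two-sided bound. -/

section Series

open Filter Topology

theorem hasSum_sub_succ_of_antitone {e : ℕ → ℝ} (he : Antitone e) (h0 : Tendsto e atTop (𝓝 0)) :
    HasSum (fun k => e k - e (k + 1)) (e 0) := by
  rw [hasSum_iff_tendsto_nat_of_nonneg fun k => sub_nonneg.2 (he (Nat.le_succ k))]
  simp only [Finset.sum_range_sub']
  simpa using h0.const_sub (e 0)

theorem hasSum_one_div_add_sq {ν : ℕ} (hν : 1 ≤ ν) :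
    HasSum (fun k : ℕ => 1 / ((ν : ℝ) + k) ^ 2)
      (Real.pi ^ 2 / 6 - ∑ j ∈ Finset.Ico 1 ν, 1 / (j : ℝ) ^ 2) := by
  have h := (hasSum_nat_add_iff' ν).2 hasSum_zeta_two
  have e : ∑ i ∈ Finset.range ν, 1 / (i : ℝ) ^ 2 = ∑ j ∈ Finset.Ico 1 ν, 1 / (j : ℝ) ^ 2 := by
    rw [Finset.range_eq_Ico, Finset.sum_eq_sum_Ico_succ_bot (by lia)]
    simp
  rw [e] at h
  refine h.congr_fun fun k => ?_
  push_cast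
  rw [add_comm]

/-- The comparison series for both bounds: `(ν + k) * (ν + k + 1)` lies strictly between consecutive
squares. -/
theorem hasSum_telescoping {ν : ℕ} (hν : 1 ≤ ν) :
    HasSum (fun k : ℕ => 1 / (((ν : ℝ) + k) * (ν + k + 1))) (1 / ν) := by
  have hpos (k : ℕ) : (0 : ℝ) < ν + k := by positivity
  have h := hasSum_sub_succ_of_antitone (e := fun k : ℕ => 1 / ((ν : ℝ) + k)) ?_ ?_
  · simp only [Nat.cast_zero, add_zero] at h
    refine h.congr_fun fun k => ?_
    have := hpos k
    push_cast
    field_simp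
    ring
  · intro i j hij
    have := hpos i
    dsimp only
    gcongr
  · simp only [one_div]
    exact (tendsto_atTop_add_const_left _ _ tendsto_natCast_atTop_atTop).inv_tendsto_atTop

theorem one_lt_mul_of_hasSum {ν : ℕ} (hν : 1 ≤ ν) {V : ℝ}
    (hV : HasSum (fun k : ℕ => 1 / ((ν : ℝ) + k) ^ 2) V) : 1 < ν * V := by
  have hν' : (0 : ℝ) < ν := by positivity
  have hlt (k : ℕ) : 1 / (((ν : ℝ) + k) * (ν + k + 1)) < 1 / ((ν : ℝ) + k) ^ 2 := by
    apply one_div_lt_one_div_of_lt (by positivity)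
    nlinarith [(Nat.cast_nonneg k : (0 : ℝ) ≤ k)]
  have := hasSum_lt (fun k => (hlt k).le) (hlt 0) (hasSum_telescoping hν) hV
  rwa [div_lt_iff₀' hν'] at this

theorem mul_lt_of_hasSum {ν : ℕ} (hν : 1 ≤ ν) {V : ℝ}
    (hV : HasSum (fun k : ℕ => 1 / ((ν : ℝ) + k) ^ 2) V) : ν * V < 1 + 1 / (ν : ℝ) := by
  have hν' : (0 : ℝ) < ν := by positivity
  -- The leading term `1 / ν ^ 2` is set aside, since only the shifted squares lie below the
  -- telescoping terms; multiplied by `ν` it is the extra `1 / ν`.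
  have h1 := (hasSum_nat_add_iff' 1).2 hV
  have hlt (k : ℕ) :
      1 / ((ν : ℝ) + (k + 1 : ℕ)) ^ 2 < 1 / (((ν : ℝ) + k) * (ν + k + 1)) := by
    apply one_div_lt_one_div_of_lt (by positivity)
    push_cast
    nlinarith [(Nat.cast_nonneg k : (0 : ℝ) ≤ k)]
  have h2 := hasSum_lt (fun k => (hlt k).le) (hlt 0) h1 (hasSum_telescoping hν)
  simp only [Finset.range_one, Finset.sum_singleton, Nat.cast_zero, add_zero] at h2
  have h3 : V < 1 / ν ^ 2 + 1 / (ν : ℝ) := by linarith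
  calc ν * V < ν * (1 / ν ^ 2 + 1 / (ν : ℝ)) := by gcongr
    _ = 1 + 1 / (ν : ℝ) := by
      field_simp
      ring

/-- Passing from `n` to `n + 1` changes the series by a telescoping one whose sum is `1 / (n + 1) ^
2`, matching the change of the closed form. The base case is the series of inverse squares. -/
theorem hasSum_one_div_sq_mul_choose (n : ℕ) :
    HasSum (fun k : ℕ => 1 / (((k : ℝ) + 1) ^ 2 * ((n + 1 + k).choose (k + 1) : ℝ)))
      (Real.pi ^ 2 / 6 - ∑ j ∈ Finset.Ico 1 (n + 1), 1 / (j : ℝ) ^ 2) := by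
  induction n with
  | zero =>
    refine (hasSum_one_div_add_sq le_rfl).congr_fun fun k => ?_
    simp [add_comm]
  | succ n ih =>
    -- Chosen so that `e k - e (k + 1)` is the difference of the `k`-th terms for `n` and `n + 1`;
    -- `e 0` is the term removed.
    set e : ℕ → ℝ := fun k => 1 / (((n : ℝ) + 1) * ((k + 1) * ((n + 1 + k).choose (k + 1) : ℝ)))
      with he
    have hC (k : ℕ) : (1 : ℝ) ≤ ((n + 1 + k).choose (k + 1) : ℝ) := by
      exact_mod_cast Nat.choose_pos (by lia)
    have hsucc (k : ℕ) : ((n + 1 + (k + 1)).choose (k + 1 + 1) : ℝ) * (k + 2) =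
        (n + k + 2) * ((n + 1 + k).choose (k + 1) : ℝ) := by
      have := Nat.add_one_mul_choose_eq (n + 1 + k) (k + 1)
      rw [add_assoc (n + 1) k 1] at this
      have h : (((n + 1 + (k + 1) : ℕ) : ℝ)) * ((n + 1 + k).choose (k + 1) : ℝ) =
        ((n + 1 + (k + 1)).choose (k + 1 + 1) : ℝ) * ((k + 1 + 1 : ℕ) : ℝ) := by exact_mod_cast this
      push_cast at h
      linarith
    have hstep (k : ℕ) : ((n + 1 + 1 + k).choose (k + 1) : ℝ) * (n + 1) =
        (n + k + 2) * ((n + 1 + k).choose (k + 1) : ℝ) := by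
      have := Nat.choose_mul_succ_eq (n + 1 + k) (k + 1)
      rw [show n + 1 + k + 1 - (k + 1) = n + 1 by lia,
        show n + 1 + k + 1 = n + 1 + 1 + k by ring] at this
      have h : ((n + 1 + k).choose (k + 1) : ℝ) * ((n + 1 + 1 + k : ℕ) : ℝ) =
        ((n + 1 + 1 + k).choose (k + 1) : ℝ) * ((n + 1 : ℕ) : ℝ) := by exact_mod_cast this
      push_cast at h
      linarith
    have hsub (k : ℕ) : e k - e (k + 1) =
        1 / (((k : ℝ) + 1) * (n + k + 2) * ((n + 1 + k).choose (k + 1) : ℝ)) := by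
      have h1 := hC k
      have h2 : ((k + 1 : ℕ) + 1 : ℝ) * ((n + 1 + (k + 1)).choose (k + 1 + 1) : ℝ) =
          (n + k + 2) * ((n + 1 + k).choose (k + 1) : ℝ) := by
        rw [← hsucc]
        push_cast
        ring
      simp only [he]
      rw [h2]
      have h3 : ((n + 1 + k).choose (k + 1) : ℝ) ≠ 0 := by linarith
      field_simp
      ring
    have hanti : Antitone e := antitone_nat_of_succ_le fun k => by
      rw [← sub_nonneg, hsub]
      positivity
    have hlim : Tendsto e atTop (𝓝 0) := by
      refine squeeze_zero (fun k => by positivity) (fun k => ?_)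
        tendsto_one_div_add_atTop_nhds_zero_nat
      apply one_div_le_one_div_of_le (by positivity)
      have h1 := hC k
      have h2 : (0 : ℝ) ≤ n := by positivity
      have h3 : (0 : ℝ) ≤ k := by positivity
      calc (k : ℝ) + 1 = 1 * ((k + 1) * 1) := by ring
        _ ≤ (n + 1) * ((k + 1) * ((n + 1 + k).choose (k + 1) : ℝ)) := by
          gcongr
          linarith
    have h := ih.sub (hasSum_sub_succ_of_antitone hanti hlim)
    rw [Finset.sum_Ico_succ_top (by lia), ← sub_sub]
    have h0 : e 0 = 1 / ((n + 1 : ℕ) : ℝ) ^ 2 := by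
      simp only [he, Nat.cast_zero, zero_add, add_zero, Nat.choose_one_right, Nat.cast_add,
        Nat.cast_one]
      ring
    rw [h0] at h
    refine h.congr_fun fun k => ?_
    rw [hsub]
    have h1 : ((n + 1 + 1 + k).choose (k + 1) : ℝ) =
        (n + k + 2) * ((n + 1 + k).choose (k + 1) : ℝ) / (n + 1) := by
      rw [← hstep]
      field_simp
    rw [h1]
    have h3 : ((n + 1 + k).choose (k + 1) : ℝ) ≠ 0 := by linarith [hC k]
    field_simp
    ring

end Series

/-! ### The exponential model. -/

section Exponential

open Filter Topology

theorem isExpFamily_expMeasure :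
    IsExpFamily (fun l : Set.Ioi (0 : ℝ) => expMeasure l) (fun x => x) where
  isProbabilityMeasure l := isProbabilityMeasure_expMeasure l.2
  measurable := measurable_id
  tilt l := by
    filter_upwards [Iio_mem_nhds (show (0 : ℝ) < l from l.2)] with t ht
    have hl : (0 : ℝ) < l := l.2
    have hlt : 0 < (l : ℝ) - t := sub_pos.2 ht
    exact ⟨⟨l - t, hlt⟩, ((l - t) / l) ^ (1 : ℝ), by positivity, gammaMeasure_tilt one_pos hl ht⟩

theorem isExpFamily_expSample (ν : ℕ) :
    IsExpFamily (fun l : Set.Ioi (0 : ℝ) => expSample ν l) (fun x => ∑ i, x i) :=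
  isExpFamily_expMeasure.pi

/-- Both sides have moment generating function `(l / (l - t)) ^ ν` for `t < l`. -/
theorem map_sum_expSample {ν : ℕ} (hν : 1 ≤ ν) {l : ℝ} (hl : 0 < l) :
    (expSample ν l).map (fun x => ∑ i, x i) = gammaMeasure ν l := by
  have := isProbabilityMeasure_expMeasure hl
  have hν' : (0 : ℝ) < ν := by positivity
  have := isProbabilityMeasure_gammaMeasure hν' hl
  have : IsProbabilityMeasure (expSample ν l) := by
    unfold expSample
    infer_instance
  have hev : ∀ᶠ t in 𝓝 (0 : ℝ), t < l := Iio_mem_nhds hl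
  have h := map_eq_map_of_mgf_eventuallyEq (μ := expSample ν l) (μ' := gammaMeasure ν l)
    (X := fun x => ∑ i, x i) (Y := fun x => x) ?_ ?_ ?_
  · rwa [Measure.map_id'] at h
  · rw [mem_interior_iff_mem_nhds]
    filter_upwards [hev] with t ht
    exact integrable_exp_sum_pi (μ := expMeasure l) (mgf_id_gammaMeasure one_pos hl ht).1
  · rw [mem_interior_iff_mem_nhds]
    filter_upwards [hev] with t ht
    exact (mgf_id_gammaMeasure hν' hl ht).1
  · filter_upwards [hev] with t ht
    have h1 := mgf_sum_pi (ι := Fin ν) (μ := expMeasure l) measurable_id t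
    have h2 := (mgf_id_gammaMeasure one_pos hl ht).2
    have h3 : mgf id (expMeasure l) t = l / (l - t) := by
      rw [Real.rpow_one] at h2
      exact h2
    rw [(mgf_id_gammaMeasure hν' hl ht).2, Real.rpow_natCast]
    rw [h3, Fintype.card_fin] at h1
    exact h1

theorem L_eq_comp (ν : ℕ) : L ν = (fun y => -Real.log y - Real.eulerMascheroniConstant +
    ∑ j ∈ Finset.Ico 1 ν, 1 / (j : ℝ)) ∘ fun x => ∑ i, x i := rfl

theorem measurable_L_of_sum (ν : ℕ) : Measurable (fun y => -Real.log y -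
    Real.eulerMascheroniConstant + ∑ j ∈ Finset.Ico 1 ν, 1 / (j : ℝ)) := by
  fun_prop

theorem harmonic_eq_sum_Ico (n : ℕ) :
    (harmonic n : ℝ) = ∑ j ∈ Finset.Ico 1 (n + 1), 1 / (j : ℝ) := by
  rw [harmonic, Finset.sum_Ico_eq_sum_range]
  push_cast
  simp [add_comm]

theorem memLp_L {ν : ℕ} (hν : 1 ≤ ν) {l : ℝ} (hl : 0 < l) : MemLp (L ν) 2 (expSample ν l) := by
  have hν' : (0 : ℝ) < ν := by positivity
  have := isProbabilityMeasure_gammaMeasure hν' hl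
  rw [L_eq_comp]
  refine MemLp.comp_of_map ?_ (by fun_prop)
  rw [map_sum_expSample hν hl]
  exact ((memLp_log_gammaMeasure hν' hl).neg.sub (memLp_const _)).add (memLp_const _)

theorem integral_L {ν : ℕ} (hν : 1 ≤ ν) {l : ℝ} (hl : 0 < l) :
    ∫ x, L ν x ∂(expSample ν l) = Real.log l := by
  have hν' : (0 : ℝ) < ν := by positivity
  have := isProbabilityMeasure_gammaMeasure hν' hl
  have hlog : Integrable Real.log (gammaMeasure ν l) :=
    (memLp_log_gammaMeasure hν' hl).integrable one_le_two
  have h := integral_map (μ := expSample ν l) (φ := fun x => ∑ i, x i) (by fun_prop)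
    (measurable_L_of_sum ν).aestronglyMeasurable
  rw [map_sum_expSample hν hl] at h
  change ∫ x, (-Real.log (∑ i, x i) - Real.eulerMascheroniConstant +
    ∑ j ∈ Finset.Ico 1 ν, 1 / (j : ℝ)) ∂(expSample ν l) = _
  have hneg : Integrable (fun y => -Real.log y) (gammaMeasure ν l) := hlog.neg
  have hsub : Integrable (fun y => -Real.log y - Real.eulerMascheroniConstant)
    (gammaMeasure ν l) := hneg.sub (integrable_const _)
  rw [← h, integral_add hsub (integrable_const _), integral_sub hneg (integrable_const _),
    integral_neg]
  simp only [integral_const, probReal_univ, one_smul]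
  obtain ⟨n, rfl⟩ : ∃ n, ν = n + 1 := ⟨ν - 1, by lia⟩
  have h2 := integral_log_gammaMeasure (n := n) hl
  push_cast
  rw [h2, harmonic_eq_sum_Ico]
  ring

theorem variance_L {ν : ℕ} (hν : 1 ≤ ν) {l : ℝ} (hl : 0 < l) :
    variance (L ν) (expSample ν l) =
      Real.pi ^ 2 / 6 - ∑ j ∈ Finset.Ico 1 ν, 1 / (j : ℝ) ^ 2 := by
  have hν' : (0 : ℝ) < ν := by positivity
  have := isProbabilityMeasure_gammaMeasure hν' hl
  rw [L_eq_comp, ← variance_map (measurable_L_of_sum ν).aemeasurable (by fun_prop),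
    map_sum_expSample hν hl, variance_add_const (by fun_prop),
    variance_sub_const (by fun_prop), variance_fun_neg]
  obtain ⟨n, rfl⟩ : ∃ n, ν = n + 1 := ⟨ν - 1, by lia⟩
  push_cast
  exact variance_log_gammaMeasure n hl

theorem isUMVUE_L {ν : ℕ} (hν : 1 ≤ ν) :
    IsUMVUE (fun l : Set.Ioi (0 : ℝ) => expSample ν l) (fun l => Real.log l) (L ν) := by
  refine (isExpFamily_expSample ν).isUMVUE (measurable_L_of_sum ν) ⟨?_, fun l => ?_, fun l => ?_⟩
    fun l => memLp_L hν l.2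
  · exact (measurable_L_of_sum ν).comp (by fun_prop)
  · have := (isExpFamily_expSample ν).isProbabilityMeasure l
    exact (memLp_L hν l.2).integrable one_le_two
  · exact integral_L hν l.2

/-- The estimator based on the single observation `i`. -/
theorem isUnbiased_single {ν : ℕ} (i : Fin ν) :
    IsUnbiased (fun l : Set.Ioi (0 : ℝ) => expSample ν l) (fun l => Real.log l)
      (fun x => -Real.eulerMascheroniConstant - Real.log (x i)) := by
  have hmap (l : Set.Ioi (0 : ℝ)) : (expSample ν l).map (Function.eval i) = gammaMeasure 1 l := by
    have := isProbabilityMeasure_expMeasure (show (0 : ℝ) < l from l.2)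
    exact (measurePreserving_eval (fun _ : Fin ν => expMeasure l) i).map_eq
  have hm : Measurable fun y => -Real.eulerMascheroniConstant - Real.log y := by fun_prop
  have hlog (l : Set.Ioi (0 : ℝ)) : Integrable Real.log (gammaMeasure 1 l) := by
    have := isProbabilityMeasure_gammaMeasure one_pos (show (0 : ℝ) < l from l.2)
    exact (memLp_log_gammaMeasure one_pos l.2).integrable one_le_two
  refine ⟨by fun_prop, fun l => ?_, fun l => ?_⟩
  · have := isProbabilityMeasure_gammaMeasure one_pos (show (0 : ℝ) < l from l.2)
    refine Integrable.comp_measurable (g := fun y => -Real.eulerMascheroniConstant - Real.log y)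
      ?_ (measurable_pi_apply i)
    have h := (integrable_const (-Real.eulerMascheroniConstant)).sub (hlog l)
    rw [← hmap l] at h
    exact h
  · have := isProbabilityMeasure_gammaMeasure one_pos (show (0 : ℝ) < l from l.2)
    have h := integral_map (μ := expSample ν l) (measurable_pi_apply i).aemeasurable
      hm.aestronglyMeasurable
    have h2 := integral_log_gammaMeasure (n := 0) (show (0 : ℝ) < l from l.2)
    simp only [Nat.cast_zero, zero_add, harmonic_zero, Rat.cast_zero, add_zero] at h2
    change _ = ∫ x, (-Real.eulerMascheroniConstant - Real.log (x i)) ∂(expSample ν l) at h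
    rw [← h]
    change ∫ y, _ ∂((expSample ν l).map (Function.eval i)) = _
    rw [hmap, integral_sub (integrable_const _) (hlog l), h2]
    simp

/-- The score is `1 / l - x` and the mean is `1 / l`, so the information is the variance of a single
observation. -/
theorem fisherInformation_exponential {l : ℝ} (hl : 0 < l) :
    fisherInformation volume exponentialPDFReal l = 1 / l ^ 2 := by
  have := isProbabilityMeasure_gammaMeasure one_pos hl
  have hexp : 0 ∈ interior (integrableExpSet (fun x => x) (gammaMeasure 1 l)) := by
    rw [mem_interior_iff_mem_nhds]
    filter_upwards [Iio_mem_nhds hl] with t ht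
    exact (mgf_id_gammaMeasure one_pos hl ht).1
  have hmean : ∫ x, x ∂(gammaMeasure 1 l) = 1 / l := by
    have h1 := hasDerivAt_mgf hexp
    have h2 : mgf (fun x => x) (gammaMeasure 1 l) =ᶠ[𝓝 0] fun t => l / (l - t) := by
      filter_upwards [Iio_mem_nhds hl] with t ht
      simpa using (mgf_id_gammaMeasure one_pos hl ht).2
    have h3 : HasDerivAt (fun t => l / (l - t)) (1 / l) 0 := by
      have := (hasDerivAt_const (0 : ℝ) l).fun_div ((hasDerivAt_id (0 : ℝ)).const_sub l)
        (by simpa using hl.ne')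
      convert! this using 1
      simp
      field_simp
    simpa using h1.unique (h3.congr_of_eventuallyEq h2)
  have hvar : variance (fun x => x) (gammaMeasure 1 l) = 1 / l ^ 2 := by
    refine tendsto_nhds_unique (tendsto_mgf_mul_mgf_neg hexp) ?_
    have h2 : Tendsto (fun t : ℝ => 1 / (l ^ 2 - t ^ 2)) (𝓝[≠] 0) (𝓝 (1 / l ^ 2)) := by
      have : ContinuousAt (fun t : ℝ => 1 / (l ^ 2 - t ^ 2)) 0 := by
        refine ContinuousAt.div (by fun_prop) (by fun_prop) (by simpa using hl.ne')
      simpa using this.tendsto.mono_left (nhdsWithin_le_nhds (s := {0}ᶜ))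
    refine h2.congr' ?_
    have hball : ∀ᶠ x : ℝ in 𝓝[≠] 0, x ∈ Set.Ioo (-l) l :=
      Filter.Eventually.filter_mono nhdsWithin_le_nhds (Ioo_mem_nhds (by linarith) hl)
    filter_upwards [self_mem_nhdsWithin, hball] with t ht0 ht
    have ht0 : t ≠ 0 := ht0
    rw [(mgf_id_gammaMeasure one_pos hl ht.2).2,
      (mgf_id_gammaMeasure one_pos hl (show -t < l by linarith [ht.1])).2]
    simp only [Real.rpow_one]
    have h3 : l - t ≠ 0 := by linarith [ht.2]
    have h4 : l - -t ≠ 0 := by linarith [ht.1]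
    have h5 : l ^ 2 - t ^ 2 ≠ 0 := by
      rw [show l ^ 2 - t ^ 2 = (l - t) * (l - -t) by ring]
      exact mul_ne_zero h3 h4
    field_simp
    ring
  rw [← hvar, variance_eq_integral measurable_id'.aemeasurable, hmean, gammaMeasure]
  have h : ∫ x, (x - 1 / l) ^ 2 ∂(volume.withDensity (gammaPDF 1 l)) =
      ∫ x, max (gammaPDFReal 1 l x) 0 * (x - 1 / l) ^ 2 :=
    integral_withDensity_ofReal (measurable_gammaPDFReal 1 l)
  rw [h, fisherInformation]
  congr 1
  ext x
  rw [max_eq_left (gammaPDFReal_nonneg one_pos hl x), exponentialPDFReal]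
  rcases lt_or_ge x 0 with hx | hx
  -- Off the support the factor `p t x` is zero, so the derivative of the logarithm plays no role.
  · simp [gammaPDFReal, not_le.2 hx]
  · have hd : HasDerivAt (fun s => Real.log (exponentialPDFReal s x)) (1 / l - x) l := by
      have h1 : HasDerivAt (fun s => Real.log s - s * x) (1 / l - x) l := by
        simpa using (Real.hasDerivAt_log hl.ne').fun_sub ((hasDerivAt_id l).mul_const x)
      refine h1.congr_of_eventuallyEq ?_
      filter_upwards [Ioi_mem_nhds hl] with s hs
      have hs : 0 < s := hs
      simp only [exponentialPDFReal, gammaPDFReal, if_pos hx]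
      rw [sub_self, Real.rpow_zero, Real.rpow_one, Real.Gamma_one, div_one, mul_one,
        Real.log_mul hs.ne' (Real.exp_ne_zero _), Real.log_exp]
      ring
    rw [hd.deriv]
    ring

theorem cramerRaoBound_exponential (ν : ℕ) {l : ℝ} (hl : 0 < l) :
    cramerRaoBound volume exponentialPDFReal Real.log ν l = 1 / ν := by
  rw [cramerRaoBound, fisherInformation_exponential hl, Real.deriv_log]
  -- For an empty sample both sides are divisions by zero, equal to `0` by convention.
  rcases eq_or_ne ν 0 with rfl | h
  · simp
  · field_simp

theorem tendsto_efficiency_L {l : ℝ} (hl : 0 < l) :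
    Tendsto (fun ν : ℕ => variance (L ν) (expSample ν l) /
      cramerRaoBound volume exponentialPDFReal Real.log ν l) atTop (𝓝 1) := by
  have hV {ν : ℕ} (hν : 1 ≤ ν) : HasSum (fun k : ℕ => 1 / ((ν : ℝ) + k) ^ 2)
      (variance (L ν) (expSample ν l)) := by
    rw [variance_L hν hl]
    exact hasSum_one_div_add_sq hν
  have hup : Tendsto (fun ν : ℕ => 1 + 1 / (ν : ℝ)) atTop (𝓝 1) := by
    simpa using tendsto_one_div_atTop_nhds_zero_nat.const_add (1 : ℝ)
  refine tendsto_of_tendsto_of_tendsto_of_le_of_le' tendsto_const_nhds hup ?_ ?_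
  all_goals
    filter_upwards [eventually_ge_atTop 1] with ν hν
    rw [cramerRaoBound_exponential ν hl, div_div_eq_mul_div, div_one, mul_comm]
  · exact (one_lt_mul_of_hasSum hν (hV hν)).le
  · exact (mul_lt_of_hasSum hν (hV hν)).le

end Exponential

/-! ### Generating series and their differential equations. -/

section PowerSeries

open PowerSeries

theorem coeff_one_sub_X_mul_derivative (F : ℝ⟦X⟧) (n : ℕ) :
    coeff n ((1 - X) * d⁄dX ℝ F) = (n + 1) * coeff (n + 1) F - n * coeff n F := by
  rw [sub_mul, one_mul, map_sub, coeff_derivative]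
  cases n with
  | zero => simp
  | succ n =>
    rw [coeff_succ_X_mul, coeff_derivative]
    push_cast
    ring

theorem coeff_X_mul_derivative (F : ℝ⟦X⟧) (n : ℕ) :
    coeff n (X * d⁄dX ℝ F) = n * coeff n F := by
  cases n with
  | zero => simp
  | succ n =>
    rw [coeff_succ_X_mul, coeff_derivative]
    push_cast
    ring

/-- The equation is a recurrence whose coefficient of the new unknown is `n + 1`, never zero, so the
constant term determines the solution. -/
theorem eq_of_one_sub_X_mul_derivative_eq {F G H : ℝ⟦X⟧} {c : ℝ} (h0 : coeff 0 F = coeff 0 G)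
    (hF : (1 - X) * d⁄dX ℝ F = C c * F + H) (hG : (1 - X) * d⁄dX ℝ G = C c * G + H) :
    F = G := by
  ext n
  induction n with
  | zero => exact h0
  | succ n ih =>
    have h1 := congrArg (coeff n) hF
    have h2 := congrArg (coeff n) hG
    rw [coeff_one_sub_X_mul_derivative, map_add, coeff_C_mul] at h1 h2
    have h3 : ((n : ℝ) + 1) * (coeff (n + 1) F - coeff (n + 1) G) = 0 := by
      rw [ih] at h1
      linarith
    have h4 : (n : ℝ) + 1 ≠ 0 := by positivity
    exact sub_eq_zero.1 ((mul_eq_zero.1 h3).resolve_left h4)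

/-- The operator multiplies the `n`-th coefficient by `n + c > 0`, so it is injective and no initial
value is needed. -/
theorem eq_of_X_mul_derivative_eq {F G H : ℝ⟦X⟧} {c : ℝ} (hc : 0 < c)
    (hF : X * d⁄dX ℝ F + C c * F = H) (hG : X * d⁄dX ℝ G + C c * G = H) : F = G := by
  ext n
  have h1 := congrArg (coeff n) (hF.trans hG.symm)
  simp only [map_add, coeff_X_mul_derivative, coeff_C_mul] at h1
  have h3 : ((n : ℝ) + c) * (coeff n F - coeff n G) = 0 := by linarith
  have h4 : (n : ℝ) + c ≠ 0 := by positivity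
  exact sub_eq_zero.1 ((mul_eq_zero.1 h3).resolve_left h4)

/-- The generating series of `f` against the negative binomial weights `(n + m).choose m`. -/
noncomputable def negBinSeries (m : ℕ) (f : ℕ → ℝ) : ℝ⟦X⟧ := mk fun n => ((n + m).choose m : ℝ) * f n

/-- The weights satisfy `(n + 1) w (n + 1) = (m + 1 + n) w n`. The operator therefore acts on `f`
through its forward difference, which is simple for the statistic `tStat`. -/
theorem negBinSeries_derivative (m : ℕ) (f : ℕ → ℝ) :
    (1 - X) * d⁄dX ℝ (negBinSeries m f) = C ((m : ℝ) + 1) * negBinSeries m f +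
      negBinSeries m fun n => ((m : ℝ) + 1 + n) * (f (n + 1) - f n) := by
  ext n
  rw [coeff_one_sub_X_mul_derivative, map_add, coeff_C_mul]
  simp only [negBinSeries, coeff_mk]
  have h : ((n : ℝ) + 1) * ((n + 1 + m).choose m : ℝ) = (m + 1 + n) * ((n + m).choose m : ℝ) := by
    have := Nat.choose_mul_succ_eq (n + m) m
    rw [show n + m + 1 - m = n + 1 by lia, show n + m + 1 = n + 1 + m by ring] at this
    have h : ((n + m).choose m : ℝ) * ((n + 1 + m : ℕ) : ℝ) =
      ((n + 1 + m).choose m : ℝ) * ((n + 1 : ℕ) : ℝ) := by exact_mod_cast this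
    push_cast at h
    linarith
  linear_combination f (n + 1) * h

/-- The series of `-log (1 - x)`. -/
noncomputable def logSeries : ℝ⟦X⟧ := mk fun n => 1 / (n : ℝ)

theorem logSeries_derivative : (1 - X) * d⁄dX ℝ logSeries = 1 := by
  ext n
  rw [coeff_one_sub_X_mul_derivative, coeff_one]
  simp only [logSeries, coeff_mk]
  have h : (n : ℝ) + 1 ≠ 0 := by positivity
  rcases eq_or_ne n 0 with rfl | hn
  -- The convention `1 / 0 = 0` gives `logSeries` the constant term it should have.
  · simp
  · have : (n : ℝ) ≠ 0 := by positivity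
    push_cast
    rw [if_neg hn]
    field_simp
    ring

/-- The variance series in powers of `1 - θ`, for sample size `m + 1`. -/
noncomputable def varSeries (m : ℕ) : ℝ⟦X⟧ := mk fun n => 1 / ((n : ℝ) ^ 2 * ((m + n).choose n : ℝ))

/-- Consecutive coefficients of the derivative have a rational ratio, and this is that recurrence as
a differential equation. `negBinSeries_inv` needs it in this form. -/
theorem varSeries_derivative (m : ℕ) :
    X * ((1 - X) * d⁄dX ℝ (d⁄dX ℝ (varSeries m))) +
      (C ((m : ℝ) + 1) - X) * d⁄dX ℝ (varSeries m) = 1 := by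
  have hg (n : ℕ) : coeff n (d⁄dX ℝ (varSeries m)) =
      1 / ((n + 1) * ((m + (n + 1)).choose (n + 1) : ℝ)) := by
    rw [coeff_derivative, varSeries, coeff_mk]
    have h1 : ((m + (n + 1)).choose (n + 1) : ℝ) ≠ 0 := by
      exact_mod_cast (Nat.choose_pos (by lia)).ne'
    push_cast
    field_simp
  ext n
  rw [sub_mul (C ((m : ℝ) + 1)), map_add, map_sub, coeff_C_mul, hg, coeff_one]
  cases n with
  | zero =>
    have : (m : ℝ) + 1 ≠ 0 := by positivity
    simp [this]
  | succ n =>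
    rw [coeff_succ_X_mul, coeff_succ_X_mul, coeff_one_sub_X_mul_derivative, hg, hg,
      if_neg (by lia)]
    have h1 : ((m + (n + 1)).choose (n + 1) : ℝ) ≠ 0 := by
      exact_mod_cast (Nat.choose_pos (by lia)).ne'
    have h2 : ((n + 1 : ℕ) + 1 : ℝ) * ((m + (n + 1 + 1)).choose (n + 1 + 1) : ℝ) =
        (m + n + 2) * ((m + (n + 1)).choose (n + 1) : ℝ) := by
      have := Nat.add_one_mul_choose_eq (m + (n + 1)) (n + 1)
      have h : ((m + (n + 1) + 1 : ℕ) : ℝ) * ((m + (n + 1)).choose (n + 1) : ℝ) =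
        ((m + (n + 1) + 1).choose (n + 1 + 1) : ℝ) * ((n + 1 + 1 : ℕ) : ℝ) := by
        exact_mod_cast this
      rw [add_assoc m (n + 1) 1] at h
      push_cast at h ⊢
      linarith
    rw [h2]
    field_simp
    ring

/-- The `T`-statistic as a function of the sample sum, for sample size `m + 1`. -/
noncomputable def tStat (m n : ℕ) : ℝ := ∑ j ∈ Finset.range n, 1 / ((m : ℝ) + 1 + j)

theorem tStat_succ (m n : ℕ) : tStat m (n + 1) = tStat m n + 1 / ((m : ℝ) + 1 + n) :=
  Finset.sum_range_succ _ _

theorem negBinSeries_one_derivative (m : ℕ) :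
    (1 - X) * d⁄dX ℝ (negBinSeries m 1) = C ((m : ℝ) + 1) * negBinSeries m 1 := by
  rw [negBinSeries_derivative]
  simp [negBinSeries, PowerSeries.ext_iff]

/-- The increment of `tStat` is `1 / (m + 1 + n)`, so the inhomogeneous term reduces to the series
of the weights; the product rule gives the same equation for the right side. -/
theorem negBinSeries_tStat (m : ℕ) :
    negBinSeries m (tStat m) = logSeries * negBinSeries m 1 := by
  refine eq_of_one_sub_X_mul_derivative_eq (c := (m : ℝ) + 1) (H := negBinSeries m 1) ?_ ?_ ?_
  · simp [negBinSeries, logSeries, tStat]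
  · rw [negBinSeries_derivative]
    congr 2
    ext n
    have : (m : ℝ) + 1 + n ≠ 0 := by positivity
    rw [tStat_succ, Pi.one_apply]
    field_simp
    ring
  · rw [Derivation.leibniz, smul_eq_mul, smul_eq_mul]
    linear_combination logSeries * negBinSeries_one_derivative m +
      negBinSeries m 1 * logSeries_derivative

/-- Multiplying the `n`-th coefficient by `n + m + 1` cancels the denominator on the left; on the
right the same operator gives the weights by `varSeries_derivative`. -/
theorem negBinSeries_inv (m : ℕ) :
    negBinSeries m (fun n => 1 / ((m : ℝ) + 1 + n)) =
      (1 - X) * (d⁄dX ℝ (varSeries m) * negBinSeries m 1) := by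
  refine eq_of_X_mul_derivative_eq (c := (m : ℝ) + 1) (H := negBinSeries m 1) (by positivity) ?_ ?_
  · ext n
    rw [map_add, coeff_X_mul_derivative, coeff_C_mul]
    simp only [negBinSeries, coeff_mk, Pi.one_apply]
    field_simp
    ring
  · simp only [Derivation.leibniz, smul_eq_mul, map_sub, Derivation.map_one_eq_zero,
      derivative_X]
    linear_combination (X * d⁄dX ℝ (varSeries m)) * negBinSeries_one_derivative m +
      negBinSeries m 1 * varSeries_derivative m

/-- The increment of the square, times `m + 1 + n`, is `2 * tStat m n + 1 / (m + 1 + n)`. The first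
summand accounts for the squared logarithm and the second, via `negBinSeries_inv`, for the variance
series. -/
theorem negBinSeries_tStat_sq (m : ℕ) :
    negBinSeries m (fun n => tStat m n ^ 2) =
      (logSeries * logSeries + varSeries m) * negBinSeries m 1 := by
  refine eq_of_one_sub_X_mul_derivative_eq (c := (m : ℝ) + 1)
    (H := 2 * negBinSeries m (tStat m) + negBinSeries m fun n => 1 / ((m : ℝ) + 1 + n)) ?_ ?_ ?_
  · simp [negBinSeries, logSeries, varSeries, tStat]
  · rw [negBinSeries_derivative]
    congr 1
    ext n
    have : (m : ℝ) + 1 + n ≠ 0 := by positivity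
    rw [map_add, two_mul, map_add]
    simp only [negBinSeries, coeff_mk, tStat_succ]
    field_simp
    ring
  · rw [negBinSeries_inv, negBinSeries_tStat]
    simp only [Derivation.leibniz, smul_eq_mul, Derivation.map_add]
    linear_combination (logSeries * logSeries + varSeries m) * negBinSeries_one_derivative m +
      2 * logSeries * negBinSeries m 1 * logSeries_derivative

theorem hasSum_coeff_mul {F G : ℝ⟦X⟧} {q x y : ℝ}
    (hF : HasSum (fun n => coeff n F * q ^ n) x) (hG : HasSum (fun n => coeff n G * q ^ n) y) :
    HasSum (fun n => coeff n (F * G) * q ^ n) (x * y) := by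
  have e : (fun n => coeff n (F * G) * q ^ n) = fun n => ∑ kl ∈ Finset.HasAntidiagonal.antidiagonal n,
      (coeff kl.1 F * q ^ kl.1) * (coeff kl.2 G * q ^ kl.2) := by
    ext n
    rw [coeff_mul, Finset.sum_mul]
    refine Finset.sum_congr rfl fun kl hkl => ?_
    rw [← Finset.HasAntidiagonal.mem_antidiagonal.1 hkl, pow_add]
    ring
  have h1 := hF.summable.norm
  have h2 := hG.summable.norm
  rw [e, ← hF.tsum_eq, ← hG.tsum_eq, tsum_mul_tsum_eq_tsum_sum_antidiagonal_of_summable_norm h1 h2]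
  exact (summable_norm_sum_mul_antidiagonal_of_summable_norm h1 h2).of_norm.hasSum

theorem hasSum_negBinSeries_one (m : ℕ) {q : ℝ} (hq : |q| < 1) :
    HasSum (fun n => coeff n (negBinSeries m 1) * q ^ n) (1 / (1 - q) ^ (m + 1)) := by
  simpa [negBinSeries] using hasSum_choose_mul_geometric_of_norm_lt_one m (r := q) hq

theorem hasSum_logSeries {q : ℝ} (hq : |q| < 1) :
    HasSum (fun n => coeff n logSeries * q ^ n) (-Real.log (1 - q)) := by
  rw [← hasSum_nat_add_iff' 1]
  simp only [logSeries, coeff_mk, Finset.range_one, Finset.sum_singleton, Nat.cast_zero, div_zero,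
    zero_mul, sub_zero]
  refine (Real.hasSum_pow_div_log_of_abs_lt_one hq).congr_fun fun n => ?_
  push_cast
  ring

theorem summable_varSeries (m : ℕ) {q : ℝ} (hq0 : 0 ≤ q) (hq : q < 1) :
    Summable (fun n => coeff n (varSeries m) * q ^ n) := by
  refine Summable.of_nonneg_of_le (fun n => ?_) (fun n => ?_) (summable_geometric_of_lt_one hq0 hq)
  · rw [varSeries, coeff_mk]
    positivity
  · rw [varSeries, coeff_mk]
    refine mul_le_of_le_one_left (by positivity) ?_
    rcases eq_or_ne n 0 with rfl | hn
    · simp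
    · have h1 : (1 : ℝ) ≤ n := by exact_mod_cast Nat.one_le_iff_ne_zero.2 hn
      have h2 : (1 : ℝ) ≤ ((m + n).choose n : ℝ) := by exact_mod_cast Nat.choose_pos (by lia)
      rw [div_le_one (by positivity)]
      nlinarith [one_le_pow₀ h1 (n := 2)]

end PowerSeries

/-! ### The geometric model. -/

section Geometric

open Filter Topology PowerSeries

/-- The geometric distribution with success probability `θ ∈ (0, 1)`. -/
noncomputable def geom (θ : Set.Ioo (0 : ℝ) 1) : Measure ℕ :=
  geometricMeasure ⟨θ.1, θ.2.1.le, θ.2.2.le⟩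

instance (θ : Set.Ioo (0 : ℝ) 1) : IsProbabilityMeasure (geom θ) :=
  isProbabilityMeasure_geometricMeasure

theorem geom_eq_sum (θ : Set.Ioo (0 : ℝ) 1) :
    geom θ = Measure.sum fun n => ENNReal.ofReal ((1 - (θ : ℝ)) ^ n * θ) • Measure.dirac n :=
  geometricMeasure_eq fun h => θ.2.1.ne' (congrArg Subtype.val h)

theorem geom_singleton (θ : Set.Ioo (0 : ℝ) 1) (n : ℕ) :
    geom θ {n} = ENNReal.ofReal ((1 - (θ : ℝ)) ^ n * θ) :=
  geometricMeasure_singleton (fun h => θ.2.1.ne' (congrArg Subtype.val h)) n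

theorem eventually_mul_exp_lt_one {q : ℝ} (hq : q < 1) : ∀ᶠ t in 𝓝 (0 : ℝ), q * Real.exp t < 1 := by
  have h : ContinuousAt (fun t => q * Real.exp t) 0 := by fun_prop
  exact h.eventually_lt_const (by simpa using hq)

theorem isExpFamily_geom : IsExpFamily geom (fun n : ℕ => (n : ℝ)) where
  isProbabilityMeasure θ := inferInstance
  measurable := measurable_from_nat
  tilt θ := by
    have h0 : (0 : ℝ) < θ := θ.2.1
    have hq0 : (0 : ℝ) < 1 - θ := sub_pos.2 θ.2.2
    filter_upwards [eventually_mul_exp_lt_one (show 1 - (θ : ℝ) < 1 by linarith)] with t ht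
    have hpos : 0 < (1 - (θ : ℝ)) * Real.exp t := by positivity
    have h1 : 0 < 1 - (1 - (θ : ℝ)) * Real.exp t := by linarith
    -- Tilting multiplies the failure probability `1 - θ` by `exp t`, which stays below one for `t`
    -- near `0`.
    refine ⟨⟨1 - (1 - θ) * Real.exp t, h1, by linarith⟩, (1 - (1 - θ) * Real.exp t) / θ,
      by positivity, Measure.ext_of_singleton fun n => ?_⟩
    rw [withDensity_apply _ (measurableSet_singleton n), lintegral_singleton, geom_singleton,
      geom_singleton, ← ENNReal.ofReal_mul (by positivity)]
    congr 1
    simp only [mul_comm t, Real.exp_nat_mul, sub_sub_cancel, mul_pow]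
    field_simp

theorem isExpFamily_geomSample (ν : ℕ) :
    IsExpFamily (geomSample ν) (fun x => ∑ i, (x i : ℝ)) :=
  isExpFamily_geom.pi

theorem mgf_geom (θ : Set.Ioo (0 : ℝ) 1) {t : ℝ} (ht : (1 - (θ : ℝ)) * Real.exp t < 1) :
    Integrable (fun n : ℕ => Real.exp (t * n)) (geom θ) ∧
      mgf (fun n : ℕ => (n : ℝ)) (geom θ) t = θ / (1 - (1 - θ) * Real.exp t) := by
  have h0 : (0 : ℝ) < θ := θ.2.1
  have hq0 : (0 : ℝ) < 1 - θ := sub_pos.2 θ.2.2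
  have hs := (hasSum_geometric_of_lt_one (by positivity) ht).mul_left (θ : ℝ)
  have e (n : ℕ) : (ENNReal.ofReal ((1 - (θ : ℝ)) ^ n * θ)).toReal * Real.exp (t * n) =
      θ * ((1 - (θ : ℝ)) * Real.exp t) ^ n := by
    rw [ENNReal.toReal_ofReal (by positivity), mul_comm t, Real.exp_nat_mul, mul_pow]
    ring
  constructor
  · rw [geom_eq_sum, integrable_sum_dirac_iff (by simp)]
    simpa [e] using hs.summable
  · rw [mgf, geom_eq_sum, integral_sum_dirac (by simp)]
    simp only [smul_eq_mul, e]
    rw [hs.tsum_eq, div_eq_mul_inv]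

/-- The negative binomial distribution of the sum of a sample of size `m + 1`, on `ℝ`. -/
noncomputable def negBin (m : ℕ) (θ : Set.Ioo (0 : ℝ) 1) : Measure ℝ :=
  Measure.sum fun n : ℕ => ENNReal.ofReal
    ((θ : ℝ) ^ (m + 1) * (((n + m).choose m : ℝ) * (1 - (θ : ℝ)) ^ n)) • Measure.dirac (n : ℝ)

theorem negBin_weight_nonneg (m : ℕ) (θ : Set.Ioo (0 : ℝ) 1) (n : ℕ) :
    0 ≤ (θ : ℝ) ^ (m + 1) * (((n + m).choose m : ℝ) * (1 - (θ : ℝ)) ^ n) := by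
  have h0 : (0 : ℝ) < θ := θ.2.1
  have hq0 : (0 : ℝ) < 1 - θ := sub_pos.2 θ.2.2
  positivity

theorem negBin_integral_of_hasSum {m : ℕ} {θ : Set.Ioo (0 : ℝ) 1} {f : ℝ → ℝ} {s : ℝ}
    (h : HasSum (fun n : ℕ => ((n + m).choose m : ℝ) * f n * (1 - (θ : ℝ)) ^ n) s) :
    Integrable f (negBin m θ) ∧ ∫ x, f x ∂(negBin m θ) = (θ : ℝ) ^ (m + 1) * s := by
  have hs := h.mul_left ((θ : ℝ) ^ (m + 1))
  have e (n : ℕ) : (ENNReal.ofReal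
      ((θ : ℝ) ^ (m + 1) * (((n + m).choose m : ℝ) * (1 - (θ : ℝ)) ^ n))).toReal * f n =
      (θ : ℝ) ^ (m + 1) * (((n + m).choose m : ℝ) * f n * (1 - (θ : ℝ)) ^ n) := by
    rw [ENNReal.toReal_ofReal (negBin_weight_nonneg m θ n)]
    ring
  constructor
  · rw [negBin, integrable_sum_dirac_iff (by simp)]
    refine hs.summable.norm.congr fun n => ?_
    rw [← e, norm_mul, Real.norm_of_nonneg ENNReal.toReal_nonneg]
  · rw [negBin, integral_sum_dirac (by simp)]
    simp only [smul_eq_mul, e]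
    exact hs.tsum_eq

theorem abs_one_sub_lt_one (θ : Set.Ioo (0 : ℝ) 1) : |1 - (θ : ℝ)| < 1 := by
  rw [abs_lt]
  constructor <;> linarith [θ.2.1, θ.2.2]

instance (m : ℕ) (θ : Set.Ioo (0 : ℝ) 1) : IsProbabilityMeasure (negBin m θ) := by
  have h0 : (0 : ℝ) < θ := θ.2.1
  refine HasSum.isProbabilityMeasure_sum_dirac (negBin_weight_nonneg m θ) ?_
  have h := (hasSum_choose_mul_geometric_of_norm_lt_one m (abs_one_sub_lt_one θ)).mul_left
    ((θ : ℝ) ^ (m + 1))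
  rw [sub_sub_cancel, mul_one_div_cancel (by positivity)] at h
  exact h

theorem mgf_negBin (m : ℕ) (θ : Set.Ioo (0 : ℝ) 1) {t : ℝ}
    (ht : (1 - (θ : ℝ)) * Real.exp t < 1) :
    Integrable (fun x => Real.exp (t * x)) (negBin m θ) ∧
      mgf (fun x => x) (negBin m θ) t = (θ / (1 - (1 - θ) * Real.exp t)) ^ (m + 1) := by
  have h0 : (0 : ℝ) < θ := θ.2.1
  have hq0 : (0 : ℝ) < 1 - θ := sub_pos.2 θ.2.2
  have hq : ‖(1 - (θ : ℝ)) * Real.exp t‖ < 1 := by rwa [Real.norm_of_nonneg (by positivity)]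
  have h := negBin_integral_of_hasSum (m := m) (θ := θ) (f := fun x => Real.exp (t * x))
    ((hasSum_choose_mul_geometric_of_norm_lt_one m hq).congr_fun fun n => by
      rw [mul_comm t, Real.exp_nat_mul, mul_pow]
      ring)
  refine ⟨h.1, ?_⟩
  rw [mgf, h.2, div_pow]
  ring

theorem map_sum_geomSample (m : ℕ) (θ : Set.Ioo (0 : ℝ) 1) :
    (geomSample (m + 1) θ).map (fun x => ∑ i, (x i : ℝ)) = negBin m θ := by
  have := (isExpFamily_geomSample (m + 1)).isProbabilityMeasure θ
  have hev := eventually_mul_exp_lt_one (show 1 - (θ : ℝ) < 1 by linarith [θ.2.1])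
  have h := map_eq_map_of_mgf_eventuallyEq (μ := geomSample (m + 1) θ) (μ' := negBin m θ)
    (X := fun x => ∑ i, (x i : ℝ)) (Y := fun x => x) ?_ ?_ ?_
  · rwa [Measure.map_id'] at h
  · rw [mem_interior_iff_mem_nhds]
    filter_upwards [hev] with t ht
    exact integrable_exp_sum_pi (μ := geom θ) (mgf_geom θ ht).1
  · rw [mem_interior_iff_mem_nhds]
    filter_upwards [hev] with t ht
    exact (mgf_negBin m θ ht).1
  · filter_upwards [hev] with t ht
    have h1 := mgf_sum_pi (ι := Fin (m + 1)) (μ := geom θ) isExpFamily_geom.measurable t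
    rw [(mgf_geom θ ht).2, Fintype.card_fin] at h1
    rw [(mgf_negBin m θ ht).2]
    exact h1

/-- The general theory takes functions of a real statistic; the floor recovers the integer sum. -/
theorem T_eq_comp (m : ℕ) :
    T (m + 1) = (fun y : ℝ => tStat m ⌊y⌋₊) ∘ fun x => ∑ i, (x i : ℝ) := by
  ext x
  simp only [Function.comp_apply, T, tStat]
  rw [← Nat.cast_sum, Nat.floor_natCast]
  push_cast
  rfl

theorem measurable_tStat_floor (m : ℕ) : Measurable fun y : ℝ => tStat m ⌊y⌋₊ :=
  (measurable_from_nat (f := tStat m)).comp Nat.measurable_floor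

theorem measurable_sum_cast (ν : ℕ) : Measurable fun x : Fin ν → ℕ => ∑ i, (x i : ℝ) :=
  (isExpFamily_geomSample ν).measurable

theorem integral_tStat_negBin (m : ℕ) (θ : Set.Ioo (0 : ℝ) 1) :
    ∫ y, tStat m ⌊y⌋₊ ∂(negBin m θ) = -Real.log θ := by
  have h0 : (0 : ℝ) < θ := θ.2.1
  have hq := abs_one_sub_lt_one θ
  have h := hasSum_coeff_mul (hasSum_logSeries hq) (hasSum_negBinSeries_one m hq)
  rw [← negBinSeries_tStat, sub_sub_cancel] at h
  rw [(negBin_integral_of_hasSum (m := m) (θ := θ) (f := fun y : ℝ => tStat m ⌊y⌋₊)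
    (h.congr_fun fun n => by simp [negBinSeries])).2]
  field_simp

theorem integral_tStat_sq_negBin (m : ℕ) (θ : Set.Ioo (0 : ℝ) 1) :
    Integrable (fun y : ℝ => tStat m ⌊y⌋₊ ^ 2) (negBin m θ) ∧
    ∫ y, tStat m ⌊y⌋₊ ^ 2 ∂(negBin m θ) =
      Real.log θ ^ 2 + ∑' n, coeff n (varSeries m) * (1 - (θ : ℝ)) ^ n := by
  have h0 : (0 : ℝ) < θ := θ.2.1
  have hq := abs_one_sub_lt_one θ
  have hV := (summable_varSeries m (q := 1 - (θ : ℝ)) (by linarith [θ.2.2])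
    (by linarith [θ.2.1])).hasSum
  have hL := hasSum_coeff_mul (hasSum_logSeries hq) (hasSum_logSeries hq)
  have hadd : HasSum (fun n => coeff n (logSeries * logSeries + varSeries m) * (1 - (θ : ℝ)) ^ n)
      _ := (hL.add hV).congr_fun fun n => by rw [map_add, add_mul]
  have h := hasSum_coeff_mul hadd (hasSum_negBinSeries_one m hq)
  rw [← negBinSeries_tStat_sq, sub_sub_cancel] at h
  have h2 := negBin_integral_of_hasSum (m := m) (θ := θ) (f := fun y : ℝ => tStat m ⌊y⌋₊ ^ 2)
    (h.congr_fun fun n => by simp [negBinSeries])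
  refine ⟨h2.1, ?_⟩
  rw [h2.2]
  field_simp

theorem memLp_tStat_negBin (m : ℕ) (θ : Set.Ioo (0 : ℝ) 1) :
    MemLp (fun y : ℝ => tStat m ⌊y⌋₊) 2 (negBin m θ) :=
  (memLp_two_iff_integrable_sq (measurable_tStat_floor m).aestronglyMeasurable).2
    (integral_tStat_sq_negBin m θ).1

theorem isUMVUE_T {ν : ℕ} (hν : 1 ≤ ν) :
    IsUMVUE (geomSample ν) (fun θ => -Real.log θ) (T ν) := by
  obtain ⟨m, rfl⟩ : ∃ m, ν = m + 1 := ⟨ν - 1, by lia⟩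
  have hX := measurable_sum_cast (m + 1)
  have h2 (θ : Set.Ioo (0 : ℝ) 1) :
      MemLp ((fun y : ℝ => tStat m ⌊y⌋₊) ∘ fun x => ∑ i, (x i : ℝ)) 2 (geomSample (m + 1) θ) := by
    refine MemLp.comp_of_map ?_ hX.aemeasurable
    rw [map_sum_geomSample]
    exact memLp_tStat_negBin m θ
  rw [T_eq_comp]
  refine (isExpFamily_geomSample (m + 1)).isUMVUE (measurable_tStat_floor m)
    ⟨(measurable_tStat_floor m).comp hX, fun θ => ?_, fun θ => ?_⟩ h2
  · have := (isExpFamily_geomSample (m + 1)).isProbabilityMeasure θ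
    exact (h2 θ).integrable one_le_two
  · have h := integral_map (μ := geomSample (m + 1) θ) hX.aemeasurable
      (measurable_tStat_floor m).aestronglyMeasurable
    rw [map_sum_geomSample, integral_tStat_negBin] at h
    exact h.symm

theorem ae_eq_T {ν : ℕ} (hν : 1 ≤ ν) {T' : (Fin ν → ℕ) → ℝ}
    (hT' : IsUMVUE (geomSample ν) (fun θ => -Real.log θ) T') (θ : Set.Ioo (0 : ℝ) 1) :
    T' =ᵐ[geomSample ν θ] T ν := by
  have h := isUMVUE_T hν
  obtain ⟨m, rfl⟩ : ∃ m, ν = m + 1 := ⟨ν - 1, by lia⟩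
  rw [T_eq_comp] at h ⊢
  exact (isExpFamily_geomSample (m + 1)).ae_eq_of_isUMVUE (measurable_tStat_floor m) h hT' θ

theorem hasSum_variance_T {ν : ℕ} (hν : 1 ≤ ν) (θ : Set.Ioo (0 : ℝ) 1) :
    HasSum (fun k : ℕ => (1 - (θ : ℝ)) ^ (k + 1) /
        (((k : ℝ) + 1) ^ 2 * ((ν + k).choose (k + 1) : ℝ)))
      (variance (T ν) (geomSample ν θ)) := by
  obtain ⟨m, rfl⟩ : ∃ m, ν = m + 1 := ⟨ν - 1, by lia⟩
  have hvar : variance (T (m + 1)) (geomSample (m + 1) θ) =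
      ∑' n, coeff n (varSeries m) * (1 - (θ : ℝ)) ^ n := by
    rw [T_eq_comp, ← variance_map (measurable_tStat_floor m).aemeasurable
      (measurable_sum_cast (m + 1)).aemeasurable, map_sum_geomSample,
      variance_eq_sub (memLp_tStat_negBin m θ), integral_tStat_negBin]
    simp only [Pi.pow_apply]
    rw [(integral_tStat_sq_negBin m θ).2]
    ring
  have hV := (summable_varSeries m (q := 1 - (θ : ℝ)) (by linarith [θ.2.2])
    (by linarith [θ.2.1])).hasSum
  -- The index is shifted by one; the dropped constant term is zero because `1 / 0 = 0`.
  rw [← hvar, ← hasSum_nat_add_iff' 1] at hV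
  simp only [varSeries, coeff_mk, Finset.range_one, Finset.sum_singleton] at hV
  norm_num at hV
  refine hV.congr_fun fun k => ?_
  rw [add_right_comm m 1 k, add_assoc m k 1]
  field_simp

theorem fisherInformation_geometric (θ : Set.Ioo (0 : ℝ) 1) :
    fisherInformation Measure.count (fun (t : ℝ) (x : ℕ) => t * (1 - t) ^ x) θ =
      1 / ((θ : ℝ) ^ 2 * (1 - θ)) := by
  obtain ⟨θ, h0, h1⟩ := θ
  have hq0 : 0 < 1 - θ := by linarith
  have hq : ‖1 - θ‖ < 1 := abs_one_sub_lt_one ⟨θ, h0, h1⟩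
  have hd (x : ℕ) : deriv (fun s => Real.log (s * (1 - s) ^ x)) θ = 1 / θ - x / (1 - θ) := by
    have h2 : HasDerivAt (fun s => Real.log s + x * Real.log (1 - s)) (1 / θ - x / (1 - θ)) θ := by
      have h3 := ((hasDerivAt_id θ).const_sub 1).log hq0.ne'
      convert! (Real.hasDerivAt_log h0.ne').fun_add (h3.const_mul (x : ℝ)) using 1
      simp only [id]
      ring
    refine (h2.congr_of_eventuallyEq ?_).deriv
    filter_upwards [Ioo_mem_nhds h0 h1] with s hs
    have hs1 : 0 < 1 - s := by linarith [hs.2]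
    rw [Real.log_mul hs.1.ne' (by positivity), Real.log_pow]
  have hs0 := hasSum_choose_mul_geometric_of_norm_lt_one 0 hq
  have hs1 := hasSum_choose_mul_geometric_of_norm_lt_one 1 hq
  have hs2 := hasSum_choose_mul_geometric_of_norm_lt_one 2 hq
  -- The squared score `(1 / θ - x / (1 - θ)) ^ 2` times `θ` is expanded in the basis `(x +
  -- 2).choose 2`, `x + 1`, `1`, using `x ^ 2 = 2 * (x + 2).choose 2 - 3 * (x + 1) + 1`.
  have hs := ((hs2.mul_left (2 * θ / (1 - θ) ^ 2)).sub
    (hs1.mul_left (3 * θ / (1 - θ) ^ 2 + 2 / (1 - θ)))).add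
    (hs0.mul_left (θ / (1 - θ) ^ 2 + 2 / (1 - θ) + 1 / θ))
  have hsum : HasSum (fun x : ℕ => (1 / θ - x / (1 - θ)) ^ 2 * (θ * (1 - θ) ^ x))
      (1 / (θ ^ 2 * (1 - θ))) := by
    convert! hs using 1
    · ext x
      rw [Nat.cast_choose_two]
      simp only [Nat.choose_one_right, Nat.choose_zero_right]
      push_cast
      field_simp
      ring
    · rw [sub_sub_cancel]
      field_simp
      ring
  simp only [fisherInformation, hd]
  rw [integral_countable (by
    rw [integrable_count_iff]
    exact hsum.summable.norm)]
  simpa using hsum.tsum_eq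

theorem cramerRaoBound_geometric (ν : ℕ) (θ : Set.Ioo (0 : ℝ) 1) :
    cramerRaoBound Measure.count (fun (t : ℝ) (x : ℕ) => t * (1 - t) ^ x)
      (fun t => -Real.log t) ν θ = (1 - (θ : ℝ)) / ν := by
  have h0 : (0 : ℝ) < θ := θ.2.1
  have hq0 : (0 : ℝ) < 1 - θ := sub_pos.2 θ.2.2
  rw [cramerRaoBound, fisherInformation_geometric, deriv.fun_neg, Real.deriv_log]
  rcases eq_or_ne ν 0 with rfl | h
  · simp
  · field_simp

end Geometric

end PearsonUMVUE

/-! ### Assembly of both models. -/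

theorem mainTheorem8 :
    -- the exponential model
    (∀ (ν : ℕ) (hν : 1 ≤ ν),
      -- `L_ν` is the (almost surely unique) UMVUE of `log l`
      PearsonUMVUE.IsUMVUE (fun l : Set.Ioi (0 : ℝ) => PearsonUMVUE.expSample ν l)
        (fun l => Real.log l) (PearsonUMVUE.L ν) ∧
      (∀ L' : (Fin ν → ℝ) → ℝ,
        PearsonUMVUE.IsUMVUE (fun l : Set.Ioi (0 : ℝ) => PearsonUMVUE.expSample ν l)
          (fun l => Real.log l) L' →
        ∀ l : ℝ, 0 < l → L' =ᵐ[PearsonUMVUE.expSample ν l] PearsonUMVUE.L ν) ∧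
      ∀ l : ℝ, 0 < l →
        -- `E[-γ - log X₁ | X] = L_ν`
        ((PearsonUMVUE.expSample ν l)[fun x : Fin ν → ℝ =>
              -Real.eulerMascheroniConstant - Real.log (x ⟨0, hν⟩) |
            MeasurableSpace.comap (fun x : Fin ν → ℝ => ∑ i, x i) inferInstance]
          =ᵐ[PearsonUMVUE.expSample ν l] PearsonUMVUE.L ν) ∧
        -- the variance series (its `k`-th term here is the term of index `k + 1 ≥ 1`)
        HasSum (fun k : ℕ => 1 / (((k : ℝ) + 1) ^ 2 * ((ν + k).choose (k + 1) : ℝ)))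
          (variance (PearsonUMVUE.L ν) (PearsonUMVUE.expSample ν l)) ∧
        -- `∑_{k ≥ ν} 1 / k²`
        HasSum (fun k : ℕ => 1 / ((ν : ℝ) + k) ^ 2)
          (variance (PearsonUMVUE.L ν) (PearsonUMVUE.expSample ν l)) ∧
        variance (PearsonUMVUE.L ν) (PearsonUMVUE.expSample ν l) =
          Real.pi ^ 2 / 6 - ∑ j ∈ Finset.Ico 1 ν, 1 / (j : ℝ) ^ 2 ∧
        -- the first term of the variance series is the Cramér–Rao bound
        PearsonUMVUE.cramerRaoBound volume exponentialPDFReal Real.log ν l = 1 / ν ∧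
        1 < ν * variance (PearsonUMVUE.L ν) (PearsonUMVUE.expSample ν l) ∧
        ν * variance (PearsonUMVUE.L ν) (PearsonUMVUE.expSample ν l) < 1 + 1 / (ν : ℝ)) ∧
    -- asymptotic efficiency of `L_ν`
    (∀ l : ℝ, 0 < l →
      Filter.Tendsto
        (fun ν : ℕ => variance (PearsonUMVUE.L ν) (PearsonUMVUE.expSample ν l) /
          PearsonUMVUE.cramerRaoBound volume exponentialPDFReal Real.log ν l)
        Filter.atTop (nhds 1)) ∧
    -- the geometric model
    (∀ ν : ℕ, 1 ≤ ν →
      PearsonUMVUE.IsUMVUE (PearsonUMVUE.geomSample ν)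
        (fun θ => -Real.log θ) (PearsonUMVUE.T ν) ∧
      (∀ T' : (Fin ν → ℕ) → ℝ,
        PearsonUMVUE.IsUMVUE (PearsonUMVUE.geomSample ν) (fun θ => -Real.log θ) T' →
        ∀ θ, T' =ᵐ[PearsonUMVUE.geomSample ν θ] PearsonUMVUE.T ν) ∧
      ∀ θ : Set.Ioo (0 : ℝ) 1,
        HasSum (fun k : ℕ => (1 - (θ : ℝ)) ^ (k + 1) /
            (((k : ℝ) + 1) ^ 2 * ((ν + k).choose (k + 1) : ℝ)))
          (variance (PearsonUMVUE.T ν) (PearsonUMVUE.geomSample ν θ)) ∧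
        PearsonUMVUE.cramerRaoBound Measure.count
            (fun (t : ℝ) (x : ℕ) => t * (1 - t) ^ x) (fun t => -Real.log t) ν θ =
          (1 - (θ : ℝ)) / ν) := by
  refine ⟨fun ν hν => ⟨PearsonUMVUE.isUMVUE_L hν, fun L' hL' l hl => ?_, fun l hl => ?_⟩,
    fun l hl => PearsonUMVUE.tendsto_efficiency_L hl,
    fun ν hν => ⟨PearsonUMVUE.isUMVUE_T hν, fun T' hT' θ => PearsonUMVUE.ae_eq_T hν hT' θ,
      fun θ => ⟨PearsonUMVUE.hasSum_variance_T hν θ, PearsonUMVUE.cramerRaoBound_geometric ν θ⟩⟩⟩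
  · exact (PearsonUMVUE.isExpFamily_expSample ν).ae_eq_of_isUMVUE (PearsonUMVUE.measurable_L_of_sum ν)
      (PearsonUMVUE.isUMVUE_L hν) hL' ⟨l, hl⟩
  · have hV := PearsonUMVUE.variance_L hν hl
    have hsum : HasSum (fun k : ℕ => 1 / ((ν : ℝ) + k) ^ 2)
        (variance (PearsonUMVUE.L ν) (PearsonUMVUE.expSample ν l)) := by
      rw [hV]
      exact PearsonUMVUE.hasSum_one_div_add_sq hν
    refine ⟨?_, ?_, hsum, hV, PearsonUMVUE.cramerRaoBound_exponential ν hl,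
      PearsonUMVUE.one_lt_mul_of_hasSum hν hsum, PearsonUMVUE.mul_lt_of_hasSum hν hsum⟩
    · exact (PearsonUMVUE.isExpFamily_expSample ν).condExp_ae_eq (PearsonUMVUE.measurable_L_of_sum ν)
        (PearsonUMVUE.isUMVUE_L hν).unbiased (PearsonUMVUE.isUnbiased_single ⟨0, hν⟩) ⟨l, hl⟩
    · rw [hV]
      obtain ⟨n, rfl⟩ : ∃ n, ν = n + 1 := ⟨ν - 1, by lia⟩
      exact PearsonUMVUE.hasSum_one_div_sq_mul_choose n
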